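/- **Conventions.** On $\mathbb{C}^{2n}=\mathbb{C}^n_x\times\mathbb{C}^n_\xi$ let $\sigma=\sum_j d\xi_j\wedge dx_j$. For a strictly plurisubharmonic (real-valued) quadratic form $\Phi$ on $\mathbb{C}^n$ put $\Lambda_\Phi=\{(x,\tfrac{2}{i}\tfrac{\partial\Phi}{\partial x}(x)) : x\in\mathbb{C}^n\}$, let $\iota_\Phi:\mathbb{C}^{2n}\to\mathbb{C}^{2n}$ be the unique antilinear involution equal to the identity on $\Lambda_\Phi$, and let $H_\Phi(\mathbb{C}^n)=L^2(\mathbb{C}^n,e^{-2\Phi}L(dx))\cap\mathrm{Hol}(\mathbb{C}^n)$, a Hilbert space. A complex linear map $\kappa:\mathbb{C}^{2n}\to\mathbb{C}^{2n}$ is canonical if it preserves $\sigma$. Let $\Phi,\Phi'$ be strictly plurisubharmonic quadratic forms on $\mathbb{C}^n$ and $\kappa$ a complex linear canonical transformation. A bounded linear map $A:H_{\Phi}(\mathbb{C}^n)\to H_{\Phi'}(\mathbb{C}^n)$ is a *realization of a Fourier integral operator associated to $\kappa$* if there are $N\ge 0$, a holomorphic quadratic form $\varphi(x,y,\theta)$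 on $\mathbb{C}^n\times\mathbb{C}^n\times\mathbb{C}^N$, a constant $a\in\mathbb{C}$, and contours $\Gamma(x)\subset\mathbb{C}^{n+N}_{y,\theta}$, $x\in\mathbb{C}^n$, such that * $\varphi$ is a non-degenerate phase function, $\mathrm{rank}(\varphi''_{\theta x}\ \varphi''_{\theta y}\ \varphi''_{\theta\theta})=N$, and generates $\kappa$: the graph of $\kappa$ is the relation $(y,-\varphi'_y(x,y,\theta))\mapsto(x,\varphi'_x(x,y,\theta))$, $\varphi'_\theta(x,y,\theta)=0$; * each $\Gamma(x)$ is a good contour: an oriented real affine subspace of real dimension $n+N$ through a critical point $(y_c(x),\theta_c(x))$ of $f_x(y,\theta)=-\mathrm{Im}\,\varphi(x,y,\theta)+\Phi(y)$ along which, for some $C>0$, $f_x(y,\theta)\le f_x(y_c(x),\theta_c(x))-\tfrac1C\,\mathrm{dist}\big((y,\theta),(y_c(x),\theta_c(x))\big)^2$; * $\displaystyle Au(x)=\iint_{\Gamma(x)}e^{i\varphi(x,y,\theta)}\,a\,u(y)\,dy\,d\theta$ for all $u\in H_{\Phi}(\mathbb{C}^n)$ and $x\in\mathbb{C}^n$.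 **Theorem.** Let $\Phi_1,\Phi_2$ be strictly plurisubharmonic quadratic forms on $\mathbb{C}^n$ and let $\kappa:\mathbb{C}^{2n}\to\mathbb{C}^{2n}$ be a complex linear canonical transformation which is positive relative to $(\Lambda_{\Phi_2},\Lambda_{\Phi_1})$, i.e. $$\frac1i\Big(\sigma(\kappa(\rho),\iota_{\Phi_2}\kappa(\rho))-\sigma(\rho,\iota_{\Phi_1}(\rho))\Big)\ge 0,\qquad \rho\in\mathbb{C}^{2n}.$$ Let $A:H_{\Phi_1}(\mathbb{C}^n)\to H_{\Phi_2}(\mathbb{C}^n)$ be a realization of a Fourier integral operator associated to $\kappa$. Then the Hilbert space adjoint $A^*:H_{\Phi_2}(\mathbb{C}^n)\to H_{\Phi_1}(\mathbb{C}^n)$ is a realization of a Fourier integral operator associated to the complex linear canonical transformation $$\kappa_{A^*}=\iota_{\Phi_1}\circ\kappa^{-1}\circ\iota_{\Phi_2},$$ and, if $A\ne 0$, this is the only complex linear canonical transformation to which $A^*$ is associated. -/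

import Mathlib

open MeasureTheory Metric Filter Topology
open scoped ComplexConjugate ComplexOrder

/-! ## Complex phase space, quadratic weights and reflections -/

/-- The phase space `ℂ²ⁿ = ℂⁿ_x × ℂⁿ_ξ`. -/
abbrev PhaseSpace (n : ℕ) : Type := (Fin n → ℂ) × (Fin n → ℂ)

/-- The complex symplectic form `σ = ∑ dξ_j ∧ dx_j`. -/
def sympForm {n : ℕ} (μ ν : PhaseSpace n) : ℂ :=
  ∑ j, (μ.2 j * ν.1 j - μ.1 j * ν.2 j)

/-- A complex linear canonical transformation preserves `σ`. -/
def IsCanonical {n : ℕ} (κ : PhaseSpace n →ₗ[ℂ] PhaseSpace n) : Prop :=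
  ∀ μ ν, sympForm (κ μ) (κ ν) = sympForm μ ν

/-- A real quadratic form `Φ` on `ℂⁿ` is strictly plurisubharmonic when its Levi form
`∑ ∂²Φ/∂x_j∂x̄_k ζ_j ζ̄_k` is positive definite. For a quadratic form the Levi form at `ζ` is a
quarter of the Laplacian of `ℂ ∋ t ↦ Φ(tζ)`, that is `(Φ(ζ) + Φ(iζ)) / 2`. -/
def StrictlyPlurisubharmonic {n : ℕ} (Φ : QuadraticForm ℝ (Fin n → ℂ)) : Prop :=
  ∀ ζ : Fin n → ℂ, ζ ≠ 0 → 0 < (Φ ζ + Φ (Complex.I • ζ)) / 2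

/-- The holomorphic gradient `∂Φ/∂x = (∂/∂Re x - i ∂/∂Im x) Φ / 2`. The polar form
`polar Φ x v = Φ(x + v) - Φ(x) - Φ(v)` is the derivative of the quadratic form `Φ` at `x` in the
direction `v`. -/
noncomputable def holGrad {n : ℕ} (Φ : QuadraticForm ℝ (Fin n → ℂ)) (x : Fin n → ℂ) :
    Fin n → ℂ := fun j =>
  (((QuadraticMap.polar Φ x (Pi.single j 1) : ℝ) : ℂ)
    - Complex.I * ((QuadraticMap.polar Φ x (Pi.single j Complex.I) : ℝ) : ℂ)) / 2

/-- The subspace `Λ_Φ = {(x, (2/i) ∂Φ/∂x(x))}` of `ℂ²ⁿ`. -/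
def LambdaSet {n : ℕ} (Φ : QuadraticForm ℝ (Fin n → ℂ)) : Set (PhaseSpace n) :=
  Set.range fun x => (x, (2 / Complex.I) • holGrad Φ x)

/-- `ι` is an antilinear involution of `ℂ²ⁿ` that is the identity on `Λ_Φ`. -/
def IsReflection {n : ℕ} (Φ : QuadraticForm ℝ (Fin n → ℂ))
    (ι : PhaseSpace n →ₛₗ[starRingEnd ℂ] PhaseSpace n) : Prop :=
  (∀ ρ, ι (ι ρ) = ρ) ∧ ∀ ρ ∈ LambdaSet Φ, ι ρ = ρ

theorem holGrad_add {n : ℕ} (Φ : QuadraticForm ℝ (Fin n → ℂ)) (x y : Fin n → ℂ) :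
    holGrad Φ (x + y) = holGrad Φ x + holGrad Φ y := by
  funext j
  simp only [holGrad, QuadraticMap.polar_add_left, Pi.add_apply]
  push_cast
  ring

theorem holGrad_smul {n : ℕ} (Φ : QuadraticForm ℝ (Fin n → ℂ)) (r : ℝ) (x : Fin n → ℂ) :
    holGrad Φ (r • x) = r • holGrad Φ x := by
  funext j
  simp only [holGrad, QuadraticMap.polar_smul_left, Pi.smul_apply, smul_eq_mul, Complex.real_smul]
  push_cast
  ring

/-- `2 ∑ ∂_jΦ(x) v_j = dΦ(x)(v) - i dΦ(x)(iv)`. -/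
theorem sum_holGrad_mul {n : ℕ} (Φ : QuadraticForm ℝ (Fin n → ℂ)) (x v : Fin n → ℂ) :
    2 * ∑ j, holGrad Φ x j * v j =
      ((QuadraticMap.polar Φ x v : ℝ) : ℂ) - Complex.I * ((QuadraticMap.polar Φ x (Complex.I • v) : ℝ) : ℂ) := by
  have key : ∀ w : Fin n → ℂ, QuadraticMap.polar Φ x w =
      ∑ j, ((w j).re * QuadraticMap.polar Φ x (Pi.single j 1)
        + (w j).im * QuadraticMap.polar Φ x (Pi.single j Complex.I)) := by
    intro w
    have hw : w = ∑ j, ((w j).re • (Pi.single j 1 : Fin n → ℂ)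
        + (w j).im • (Pi.single j Complex.I : Fin n → ℂ)) := by
      funext k
      simp only [Finset.sum_apply, Pi.add_apply, Pi.smul_apply, Pi.single_apply]
      rw [Finset.sum_eq_single k]
      · simp [Complex.re_add_im]
      · intro b _ hb
        simp [hb.symm]
      · simp
    conv_lhs => rw [hw]
    change QuadraticMap.polarBilin Φ x _ = _
    rw [map_sum]
    refine Finset.sum_congr rfl fun j _ => ?_
    rw [map_add, map_smul, map_smul]
    rfl
  rw [key v, key (Complex.I • v), Finset.mul_sum]
  push_cast
  rw [Finset.mul_sum, ← Finset.sum_sub_distrib]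
  refine Finset.sum_congr rfl fun j _ => ?_
  have hv : v j = (v j).re + (v j).im * Complex.I := (Complex.re_add_im _).symm
  simp only [holGrad, Pi.smul_apply, smul_eq_mul, Complex.mul_re, Complex.mul_im, Complex.I_re,
    Complex.I_im]
  push_cast
  conv_lhs => rw [hv]
  ring_nf
  simp only [Complex.I_sq]
  ring

/-- `Λ_Φ` as a real linear subspace. -/
noncomputable def LambdaSubmodule {n : ℕ} (Φ : QuadraticForm ℝ (Fin n → ℂ)) :
    Submodule ℝ (PhaseSpace n) where
  carrier := LambdaSet Φ
  zero_mem' := ⟨0, by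
    have := holGrad_smul Φ 0 0
    rw [zero_smul, zero_smul] at this
    simp [this]⟩
  add_mem' := by
    rintro _ _ ⟨x, rfl⟩ ⟨y, rfl⟩
    exact ⟨x + y, by simp [holGrad_add]⟩
  smul_mem' := by
    rintro r _ ⟨x, rfl⟩
    exact ⟨r • x, by simp [holGrad_smul, smul_comm r]⟩

/-- `Λ_Φ` is totally real. -/
theorem eq_zero_of_mem_Lambda {n : ℕ} {Φ : QuadraticForm ℝ (Fin n → ℂ)}
    (hΦ : StrictlyPlurisubharmonic Φ) {ρ : PhaseSpace n} (h₁ : ρ ∈ LambdaSet Φ)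
    (h₂ : Complex.I • ρ ∈ LambdaSet Φ) : ρ = 0 := by
  obtain ⟨x, rfl⟩ := h₁
  obtain ⟨y, hy⟩ := h₂
  simp only [Prod.smul_mk, Prod.mk.injEq] at hy
  obtain ⟨rfl, hy⟩ := hy
  have hg : holGrad Φ (Complex.I • x) = Complex.I • holGrad Φ x := by
    rw [smul_comm Complex.I] at hy
    exact smul_right_injective _ (show (2 / Complex.I : ℂ) ≠ 0 by simp) hy
  have h1 := sum_holGrad_mul Φ x x
  have h2 := sum_holGrad_mul Φ (Complex.I • x) x
  have h3 : ∑ j, holGrad Φ (Complex.I • x) j * x j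
      = Complex.I * ∑ j, holGrad Φ x j * x j := by
    rw [hg, Finset.mul_sum]
    simp [mul_assoc]
  rw [h3, show (2 : ℂ) * (Complex.I * ∑ j, holGrad Φ x j * x j)
    = Complex.I * (2 * ∑ j, holGrad Φ x j * x j) by ring, h1,
    QuadraticMap.polar_self, QuadraticMap.polar_self] at h2
  have h4 := congrArg Complex.im h2
  simp at h4
  by_contra hx
  have hx' : x ≠ 0 := by
    rintro rfl
    apply hx
    have := holGrad_smul Φ 0 0
    rw [zero_smul, zero_smul] at this
    simp [this]
  have := hΦ x hx'
  linarith

theorem exists_Lambda_decomp {n : ℕ} {Φ : QuadraticForm ℝ (Fin n → ℂ)}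
    (hΦ : StrictlyPlurisubharmonic Φ) (ρ : PhaseSpace n) :
    ∃ μ ∈ LambdaSet Φ, ∃ ν ∈ LambdaSet Φ, ρ = μ + Complex.I • ν := by
  let g : (Fin n → ℂ) →ₗ[ℝ] PhaseSpace n :=
    { toFun := fun x => (x, (2 / Complex.I) • holGrad Φ x)
      map_add' := fun x y => by simp [holGrad_add]
      map_smul' := fun r x => by simp [holGrad_smul, smul_comm r] }
  let f : ((Fin n → ℂ) × (Fin n → ℂ)) →ₗ[ℝ] PhaseSpace n :=
    { toFun := fun p => g p.1 + Complex.I • g p.2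
      map_add' := fun p q => by simp only [Prod.fst_add, Prod.snd_add, map_add, smul_add]; abel
      map_smul' := fun r p => by
        simp only [Prod.smul_fst, Prod.smul_snd, map_smul, smul_add, RingHom.id_apply,
          smul_comm r Complex.I] }
  have hinj : Function.Injective f := by
    rw [injective_iff_map_eq_zero]
    rintro ⟨x, y⟩ hxy
    have h : Complex.I • g y = g (-x) := by
      have : g x + Complex.I • g y = 0 := hxy
      rw [map_neg]
      exact eq_neg_of_add_eq_zero_right this
    have hy : g y = 0 := eq_zero_of_mem_Lambda hΦ ⟨y, rfl⟩ (h ▸ ⟨-x, rfl⟩)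
    have hy' : y = 0 := congrArg Prod.fst hy
    have hx : g (-x) = 0 := by rw [← h, hy, smul_zero]
    have hx' : -x = 0 := congrArg Prod.fst hx
    rw [neg_eq_zero] at hx'
    rw [hx', hy']
    rfl
  obtain ⟨⟨x, y⟩, h⟩ := LinearMap.surjective_of_injective (f := f) hinj ρ
  exact ⟨g x, ⟨x, rfl⟩, g y, ⟨y, rfl⟩, h.symm⟩

/-- For a strictly plurisubharmonic quadratic form there is exactly one antilinear involution of
`ℂ²ⁿ` that is the identity on `Λ_Φ`. -/
theorem existsUnique_reflection {n : ℕ} {Φ : QuadraticForm ℝ (Fin n → ℂ)}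
    (hΦ : StrictlyPlurisubharmonic Φ) :
    ∃! ι : PhaseSpace n →ₛₗ[starRingEnd ℂ] PhaseSpace n, IsReflection Φ ι := by
  choose a ha b hb hab using exists_Lambda_decomp hΦ
  have huniq : ∀ μ ∈ LambdaSet Φ, ∀ ν ∈ LambdaSet Φ, ∀ μ' ∈ LambdaSet Φ, ∀ ν' ∈ LambdaSet Φ,
      μ + Complex.I • ν = μ' + Complex.I • ν' → μ = μ' ∧ ν = ν' := by
    intro μ hμ ν hν μ' hμ' ν' hν' h
    have h1 : Complex.I • (ν - ν') = μ' - μ := by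
      rw [smul_sub]
      linear_combination h
    have h2 : ν - ν' = 0 := eq_zero_of_mem_Lambda hΦ
      ((LambdaSubmodule Φ).sub_mem hν hν') (h1 ▸ (LambdaSubmodule Φ).sub_mem hμ' hμ)
    rw [h2, smul_zero] at h1
    exact ⟨(sub_eq_zero.1 h1.symm).symm, sub_eq_zero.1 h2⟩
  have hval : ∀ μ ∈ LambdaSet Φ, ∀ ν ∈ LambdaSet Φ,
      a (μ + Complex.I • ν) = μ ∧ b (μ + Complex.I • ν) = ν := fun μ hμ ν hν =>
    huniq _ (ha _) _ (hb _) _ hμ _ hν (hab _).symm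
  have hadd : ∀ x y, a (x + y) = a x + a y ∧ b (x + y) = b x + b y := by
    intro x y
    have := hval (a x + a y) ((LambdaSubmodule Φ).add_mem (ha x) (ha y)) (b x + b y)
      ((LambdaSubmodule Φ).add_mem (hb x) (hb y))
    have e : a x + a y + Complex.I • (b x + b y) = x + y := by
      conv_rhs => rw [hab x, hab y]
      rw [smul_add]; abel
    rwa [e] at this
  have hsmul : ∀ (c : ℂ) x, a (c • x) = c.re • a x - c.im • b x
      ∧ b (c • x) = c.re • b x + c.im • a x := by
    intro c x
    have := hval (c.re • a x - c.im • b x) ((LambdaSubmodule Φ).sub_mem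
      ((LambdaSubmodule Φ).smul_mem _ (ha x)) ((LambdaSubmodule Φ).smul_mem _ (hb x)))
      (c.re • b x + c.im • a x) ((LambdaSubmodule Φ).add_mem
      ((LambdaSubmodule Φ).smul_mem _ (hb x)) ((LambdaSubmodule Φ).smul_mem _ (ha x)))
    have e : c.re • a x - c.im • b x + Complex.I • (c.re • b x + c.im • a x) = c • x := by
      conv_rhs => rw [hab x, ← Complex.re_add_im c]
      simp only [← Complex.coe_smul, add_smul, smul_add, smul_smul]
      have : (c.im : ℂ) * Complex.I * Complex.I = -c.im := by
        rw [mul_assoc, Complex.I_mul_I]; ring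
      rw [add_mul, this, add_smul, neg_smul, mul_comm Complex.I, mul_comm Complex.I]
      abel
    rwa [e] at this
  let ι : PhaseSpace n →ₛₗ[starRingEnd ℂ] PhaseSpace n :=
    { toFun := fun x => a x - Complex.I • b x
      map_add' := fun x y => by rw [(hadd x y).1, (hadd x y).2, smul_add]; abel
      map_smul' := fun c x => by
        rw [(hsmul c x).1, (hsmul c x).2]
        have : (starRingEnd ℂ) c = c.re - c.im * Complex.I := by
          apply Complex.ext <;> simp
        rw [this]
        simp only [← Complex.coe_smul, sub_smul, smul_sub, smul_add, smul_smul]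
        have : (c.im : ℂ) * Complex.I * Complex.I = -c.im := by
          rw [mul_assoc, Complex.I_mul_I]; ring
        rw [sub_mul, this, sub_smul, neg_smul, mul_comm Complex.I, mul_comm Complex.I]
        abel }
  refine ⟨ι, ⟨fun ρ => ?_, fun ρ hρ => ?_⟩, fun ι' hι' => ?_⟩
  · have h := hval (a ρ) (ha ρ) (-b ρ) ((LambdaSubmodule Φ).neg_mem (hb ρ))
    have e : ι ρ = a ρ + Complex.I • (-b ρ) := by
      change a ρ - Complex.I • b ρ = _
      rw [smul_neg, sub_eq_add_neg]
    rw [← e] at h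
    change a (ι ρ) - Complex.I • b (ι ρ) = ρ
    rw [h.1, h.2]
    conv_rhs => rw [hab ρ]
    rw [smul_neg, sub_neg_eq_add]
  · have h := hval ρ hρ 0 (LambdaSubmodule Φ).zero_mem
    rw [smul_zero, add_zero] at h
    change a ρ - Complex.I • b ρ = ρ
    rw [h.1, h.2, smul_zero, sub_zero]
  · ext1 ρ
    change ι' ρ = a ρ - Complex.I • b ρ
    conv_lhs => rw [hab ρ]
    rw [map_add, LinearMap.map_smulₛₗ, hι'.2 _ (ha ρ), hι'.2 _ (hb ρ), Complex.conj_I, neg_smul,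
      sub_eq_add_neg]

/-- The reflection `ι_Φ`: the unique antilinear involution of `ℂ²ⁿ` equal to the identity on
`Λ_Φ`. -/
noncomputable def reflection {n : ℕ} {Φ : QuadraticForm ℝ (Fin n → ℂ)}
    (hΦ : StrictlyPlurisubharmonic Φ) : PhaseSpace n →ₛₗ[starRingEnd ℂ] PhaseSpace n :=
  (existsUnique_reflection hΦ).choose

theorem isReflection_reflection {n : ℕ} {Φ : QuadraticForm ℝ (Fin n → ℂ)}
    (hΦ : StrictlyPlurisubharmonic Φ) : IsReflection Φ (reflection hΦ) :=
  (existsUnique_reflection hΦ).choose_spec.1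

/-- `κ` is positive relative to `(Λ_{Φ₂}, Λ_{Φ₁})`; the inequality is that of `ℂ`, so it says that
the left hand side is real and non-negative. -/
def IsPositiveRel {n : ℕ} {Φ₂ Φ₁ : QuadraticForm ℝ (Fin n → ℂ)}
    (hΦ₂ : StrictlyPlurisubharmonic Φ₂) (hΦ₁ : StrictlyPlurisubharmonic Φ₁)
    (κ : PhaseSpace n →ₗ[ℂ] PhaseSpace n) : Prop :=
  ∀ ρ, 0 ≤ (1 / Complex.I) *
    (sympForm (κ ρ) (reflection hΦ₂ (κ ρ)) - sympForm ρ (reflection hΦ₁ ρ))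

/-! ## Bargmann spaces -/

/-- The measure `e^{-2Φ} L(dx)` on `ℂⁿ`. -/
noncomputable def weightMeasure {n : ℕ} (Φ : QuadraticForm ℝ (Fin n → ℂ)) :
    Measure (Fin n → ℂ) :=
  volume.withDensity fun x => ENNReal.ofReal (Real.exp (-2 * Φ x))

/-- The entire functions on `ℂⁿ` that belong to `L²(ℂⁿ, e^{-2Φ} L(dx))`. -/
def bargmannSubmodule {n : ℕ} (Φ : QuadraticForm ℝ (Fin n → ℂ)) :
    Submodule ℂ ((Fin n → ℂ) → ℂ) where
  carrier := {u | Differentiable ℂ u ∧ MemLp u 2 (weightMeasure Φ)}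
  zero_mem' := ⟨differentiable_const 0, MemLp.zero⟩
  add_mem' := fun hu hv => ⟨hu.1.add hv.1, hu.2.add hv.2⟩
  smul_mem' := fun c _ hu => ⟨hu.1.const_smul c, hu.2.const_smul c⟩

/-- The Bargmann space `H_Φ(ℂⁿ) = L²(ℂⁿ, e^{-2Φ} L(dx)) ∩ Hol(ℂⁿ)`. -/
def BargmannSpace {n : ℕ} (Φ : QuadraticForm ℝ (Fin n → ℂ)) : Type :=
  bargmannSubmodule Φ

namespace BargmannSpace

variable {n : ℕ} {Φ : QuadraticForm ℝ (Fin n → ℂ)}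

noncomputable instance : AddCommGroup (BargmannSpace Φ) :=
  inferInstanceAs (AddCommGroup (bargmannSubmodule Φ))

noncomputable instance : Module ℂ (BargmannSpace Φ) :=
  inferInstanceAs (Module ℂ (bargmannSubmodule Φ))

/-- The entire function underlying an element of `H_Φ`. -/
def toFun (u : BargmannSpace Φ) : (Fin n → ℂ) → ℂ := Subtype.val u

instance : CoeFun (BargmannSpace Φ) fun _ => (Fin n → ℂ) → ℂ := ⟨toFun⟩

theorem ext {u v : BargmannSpace Φ} (h : ∀ x, u x = v x) : u = v :=
  Subtype.ext (funext h)

theorem add_apply (u v : BargmannSpace Φ) (x : Fin n → ℂ) : (u + v) x = u x + v x := rfl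

theorem sub_apply (u v : BargmannSpace Φ) (x : Fin n → ℂ) : (u - v) x = u x - v x := rfl

theorem smul_apply (c : ℂ) (u : BargmannSpace Φ) (x : Fin n → ℂ) : (c • u) x = c * u x := rfl

theorem differentiable (u : BargmannSpace Φ) : Differentiable ℂ u := u.2.1

theorem memLp (u : BargmannSpace Φ) : MemLp u 2 (weightMeasure Φ) := u.2.2

theorem integrable_inner (u v : BargmannSpace Φ) :
    Integrable (fun x => conj (u x) * v x) (weightMeasure Φ) :=
  u.memLp.star.integrable_mul v.memLp

theorem continuous_weight (Φ : QuadraticForm ℝ (Fin n → ℂ)) : Continuous Φ := by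
  have h : ∀ x, Φ x = Φ.polarBilin x x / 2 := fun x => by
    rw [QuadraticMap.polarBilin_apply_apply, QuadraticMap.polar_self]; simp
  have h2 : Continuous fun x => Φ.polarBilin.toContinuousBilinearMap x x :=
    (Φ.polarBilin.toContinuousBilinearMap.continuous).clm_apply continuous_id
  have : (Φ : (Fin n → ℂ) → ℝ) = fun x => Φ.polarBilin.toContinuousBilinearMap x x / 2 :=
    funext fun x => by rw [h x]; rfl
  rw [this]
  exact h2.div_const 2

theorem measurable_density (Φ : QuadraticForm ℝ (Fin n → ℂ)) :
    Measurable fun x => ENNReal.ofReal (Real.exp (-2 * Φ x)) :=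
  (Real.continuous_exp.comp (continuous_const.mul (continuous_weight Φ))).measurable.ennreal_ofReal

theorem volume_absolutelyContinuous (Φ : QuadraticForm ℝ (Fin n → ℂ)) :
    (volume : Measure (Fin n → ℂ)) ≪ weightMeasure Φ :=
  withDensity_absolutelyContinuous' (measurable_density Φ).aemeasurable
    (Filter.Eventually.of_forall fun x => by simp [Real.exp_pos])

theorem eq_of_ae_eq {f g : (Fin n → ℂ) → ℂ} (hf : Continuous f) (hg : Continuous g)
    (h : f =ᵐ[weightMeasure Φ] g) : f = g :=
  Continuous.ae_eq_iff_eq volume hf hg |>.1 ((volume_absolutelyContinuous Φ).ae_eq h)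

/-- The inner product `(u, v) = ∫ conj (u x) v(x) e^{-2Φ(x)} L(dx)`. -/
@[reducible]
noncomputable def core (Φ : QuadraticForm ℝ (Fin n → ℂ)) :
    InnerProductSpace.Core ℂ (BargmannSpace Φ) where
  inner u v := ∫ x, conj (u x) * v x ∂(weightMeasure Φ)
  conj_inner_symm u v := by
    rw [← integral_conj]
    refine integral_congr_ae (Filter.Eventually.of_forall fun x => ?_)
    simp [mul_comm]
  re_inner_nonneg u := by
    have : (fun x => conj (u x) * u x) = fun x => ((‖u x‖ ^ 2 : ℝ) : ℂ) := by
      funext x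
      rw [mul_comm, Complex.mul_conj, Complex.normSq_eq_norm_sq]
    rw [this, integral_complex_ofReal]
    exact integral_nonneg fun x => by positivity
  add_left u v w := by
    rw [← integral_add (integrable_inner u w) (integrable_inner v w)]
    simp [add_apply, add_mul]
  smul_left u v c := by
    rw [← integral_const_mul]
    simp [smul_apply, mul_assoc]
  definite u hu := by
    have : (fun x => conj (u x) * u x) = fun x => ((‖u x‖ ^ 2 : ℝ) : ℂ) := by
      funext x
      rw [mul_comm, Complex.mul_conj, Complex.normSq_eq_norm_sq]
    rw [this, integral_complex_ofReal, Complex.ofReal_eq_zero,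
      integral_eq_zero_iff_of_nonneg (fun x => by positivity)
        ((memLp_two_iff_integrable_sq_norm u.memLp.1).1 u.memLp)] at hu
    have h0 : (u : (Fin n → ℂ) → ℂ) = fun _ => 0 :=
      eq_of_ae_eq (Φ := Φ) u.differentiable.continuous continuous_const
        (hu.mono fun x hx => by simpa using hx)
    exact ext fun x => congrFun h0 x

noncomputable instance : NormedAddCommGroup (BargmannSpace Φ) :=
  @InnerProductSpace.Core.toNormedAddCommGroup ℂ (BargmannSpace Φ) _ _ _ (core Φ)

noncomputable instance : InnerProductSpace ℂ (BargmannSpace Φ) :=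
  InnerProductSpace.ofCore (core Φ).toCore

theorem inner_def (u v : BargmannSpace Φ) :
    inner ℂ u v = ∫ x, conj (u x) * v x ∂(weightMeasure Φ) := rfl

/-- The isometric inclusion of `H_Φ` into `L²(e^{-2Φ} L(dx))`. -/
noncomputable def toL2 (Φ : QuadraticForm ℝ (Fin n → ℂ)) :
    BargmannSpace Φ →ₗᵢ[ℂ] Lp ℂ 2 (weightMeasure Φ) :=
  LinearMap.isometryOfInner
    { toFun := fun u => u.memLp.toLp u
      map_add' := fun _ _ => rfl
      map_smul' := fun _ _ => rfl }
    fun u v => by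
      rw [inner_def, L2.inner_def]
      refine integral_congr_ae ?_
      filter_upwards [u.memLp.coeFn_toLp, v.memLp.coeFn_toLp] with x hx hy
      change inner ℂ ((u.memLp.toLp u) x) ((v.memLp.toLp v) x) = _
      rw [hx, hy, mul_comm]
      rfl

theorem norm_eq (u : BargmannSpace Φ) : ‖u‖ = (eLpNorm u 2 (weightMeasure Φ)).toReal := by
  rw [← (toL2 Φ).norm_map u]
  exact Lp.norm_toLp _ u.memLp

/-- The sub-mean value property of entire functions on balls. -/
theorem enorm_mul_volume_le {u : (Fin n → ℂ) → ℂ} (hu : Differentiable ℂ u) (x : Fin n → ℂ) :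
    ‖u x‖ₑ * volume (closedBall (0 : Fin n → ℂ) 1)
      ≤ ∫⁻ w in closedBall (0 : Fin n → ℂ) 1, ‖u (x + w)‖ₑ := by
  set B := closedBall (0 : Fin n → ℂ) 1
  set T : Measure ℝ := volume.restrict (Set.Ioc 0 (2 * Real.pi))
  have hT : T Set.univ = ENNReal.ofReal (2 * Real.pi) := by simp [T]
  have hpi : ENNReal.ofReal (2 * Real.pi) ≠ 0 := by
    simp [Real.pi_pos]
  have hmv : ∀ w, ‖u x‖ₑ * ENNReal.ofReal (2 * Real.pi)
      ≤ ∫⁻ t, ‖u (x + circleMap 0 1 t • w)‖ₑ ∂T := by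
    intro w
    have hd : Differentiable ℂ fun z : ℂ => u (x + z • w) :=
      hu.comp ((differentiable_const x).add (differentiable_id.smul_const w))
    have h := (hd.diffContOnCl (s := ball 0 |1|)).circleAverage
    rw [Real.circleAverage_def, intervalIntegral.integral_of_le Real.two_pi_pos.le] at h
    simp only [zero_smul, add_zero] at h
    have h' : u x * (2 * Real.pi : ℝ) = ∫ t, u (x + circleMap 0 1 t • w) ∂T := by
      rw [← h, Complex.real_smul]
      have : ((2 * Real.pi : ℝ) : ℂ) ≠ 0 := by exact_mod_cast Real.two_pi_pos.ne'
      rw [Complex.ofReal_inv]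
      field_simp
      rfl
    calc ‖u x‖ₑ * ENNReal.ofReal (2 * Real.pi)
        = ‖u x * (2 * Real.pi : ℝ)‖ₑ := by
          rw [enorm_mul]
          congr 1
          rw [← ofReal_norm, Complex.norm_real,
            Real.norm_of_nonneg Real.two_pi_pos.le]
      _ ≤ _ := by rw [h']; exact enorm_integral_le_lintegral_enorm _
  have hrot : ∀ t : ℝ, ∫⁻ w in B, ‖u (x + circleMap 0 1 t • w)‖ₑ = ∫⁻ w in B, ‖u (x + w)‖ₑ := by
    intro t
    have hc : ‖circleMap 0 1 t‖ = 1 := by simp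
    let e : ℂ ≃ₗᵢ[ℝ] ℂ := rotation ⟨circleMap 0 1 t, by simp [Submonoid.unitSphere]⟩
    have hmp : MeasurePreserving (fun (w : Fin n → ℂ) => circleMap 0 1 t • w) volume volume :=
      volume_preserving_pi (f := fun _ => e) fun _ => e.measurePreserving
    have hpre : (fun (w : Fin n → ℂ) => circleMap 0 1 t • w) ⁻¹' B = B := by
      ext w
      simp [B, norm_smul]
    have h := hmp.setLIntegral_comp_preimage (s := B) measurableSet_closedBall
      (f := fun w => ‖u (x + w)‖ₑ)
      (hu.continuous.comp (continuous_const.add continuous_id)).measurable.enorm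
    rw [hpre] at h
    exact h
  have hswap : ∫⁻ w in B, (∫⁻ t, ‖u (x + circleMap 0 1 t • w)‖ₑ ∂T)
      = ∫⁻ t, (∫⁻ w in B, ‖u (x + circleMap 0 1 t • w)‖ₑ) ∂T := by
    refine lintegral_lintegral_swap ?_
    refine Measurable.aemeasurable ?_
    refine Measurable.enorm (Continuous.measurable ?_)
    exact hu.continuous.comp (continuous_const.add
      (((continuous_circleMap 0 1).comp continuous_snd).smul continuous_fst))
  have h1 : ‖u x‖ₑ * ENNReal.ofReal (2 * Real.pi) * volume B
      ≤ (∫⁻ w in B, ‖u (x + w)‖ₑ) * ENNReal.ofReal (2 * Real.pi) := by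
    calc ‖u x‖ₑ * ENNReal.ofReal (2 * Real.pi) * volume B
        = ∫⁻ _ in B, ‖u x‖ₑ * ENNReal.ofReal (2 * Real.pi) := by simp
      _ ≤ ∫⁻ w in B, (∫⁻ t, ‖u (x + circleMap 0 1 t • w)‖ₑ ∂T) :=
          lintegral_mono fun w => hmv w
      _ = ∫⁻ _, (∫⁻ w in B, ‖u (x + w)‖ₑ) ∂T := by
          rw [hswap]; exact lintegral_congr hrot
      _ = _ := by rw [lintegral_const, hT]
  rw [mul_right_comm] at h1
  exact (ENNReal.mul_le_mul_iff_left hpi ENNReal.ofReal_ne_top).1 h1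

/-- Point evaluations are bounded on `H_Φ`, locally uniformly. -/
theorem exists_bound (Φ : QuadraticForm ℝ (Fin n → ℂ)) (R : ℝ) :
    ∃ C : ℝ, 0 ≤ C ∧ ∀ u : BargmannSpace Φ, ∀ x ∈ closedBall (0 : Fin n → ℂ) R,
      ‖u x‖ ≤ C * ‖u‖ := by
  set B := closedBall (0 : Fin n → ℂ) 1
  set K := closedBall (0 : Fin n → ℂ) (R + 1)
  have hK : IsCompact K := isCompact_closedBall _ _
  obtain ⟨M, hM⟩ := hK.bddAbove_image (f := Φ) (continuous_weight Φ).continuousOn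
  set c : ENNReal := ENNReal.ofReal (Real.exp (2 * M))
  have hc : ∀ x ∈ K, 1 ≤ c * ENNReal.ofReal (Real.exp (-2 * Φ x)) := by
    intro x hx
    have := hM (Set.mem_image_of_mem Φ hx)
    rw [← ENNReal.ofReal_mul (Real.exp_pos _).le, ← Real.exp_add, ENNReal.one_le_ofReal]
    exact Real.one_le_exp (by linarith)
  have hle : volume.restrict K ≤ c • weightMeasure Φ := by
    refine Measure.le_iff.2 fun s hs => ?_
    rw [Measure.restrict_apply hs, Measure.smul_apply, smul_eq_mul, weightMeasure,
      withDensity_apply _ hs, ← lintegral_const_mul _ (measurable_density Φ)]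
    calc volume (s ∩ K) = ∫⁻ _ in s ∩ K, 1 := by simp
      _ ≤ ∫⁻ x in s ∩ K, c * ENNReal.ofReal (Real.exp (-2 * Φ x)) :=
          setLIntegral_mono' (hs.inter measurableSet_closedBall) fun x hx => hc x hx.2
      _ ≤ _ := lintegral_mono_set Set.inter_subset_left
  set V := volume B
  have hV0 : V ≠ 0 := (measure_closedBall_pos volume _ one_pos).ne'
  have hVt : V ≠ ⊤ := measure_closedBall_lt_top.ne
  have hKt : volume K ≠ ⊤ := hK.measure_lt_top.ne
  set D : ENNReal := c ^ (1 / 2 : ℝ) * volume K ^ (1 / 2 : ℝ)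
  have hD : D ≠ ⊤ := ENNReal.mul_ne_top
    (ENNReal.rpow_ne_top_of_nonneg (by norm_num) ENNReal.ofReal_ne_top)
    (ENNReal.rpow_ne_top_of_nonneg (by norm_num) hKt)
  refine ⟨(D / V).toReal, ENNReal.toReal_nonneg, fun u x hx => ?_⟩
  have h1 : ∫⁻ w in B, ‖u (x + w)‖ₑ ≤ ∫⁻ w in K, ‖u w‖ₑ := by
    have hmp : MeasurePreserving (fun w : Fin n → ℂ => x + w) volume volume :=
      measurePreserving_add_left volume x
    have h := hmp.setLIntegral_comp_preimage (s := closedBall x 1) measurableSet_closedBall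
      (f := fun w => ‖u w‖ₑ) u.differentiable.continuous.measurable.enorm
    have hpre : (fun w : Fin n → ℂ => x + w) ⁻¹' closedBall x 1 = B := by
      ext w
      simp [B]
    rw [hpre] at h
    rw [h]
    refine lintegral_mono_set (closedBall_subset_closedBall' ?_)
    rw [mem_closedBall] at hx
    linarith
  have h2 : ∫⁻ w in K, ‖u w‖ₑ ≤ D * eLpNorm u 2 (weightMeasure Φ) := by
    have ha := eLpNorm_le_eLpNorm_mul_rpow_measure_univ (μ := volume.restrict K) (p := 1) (q := 2)
      (by norm_num) (f := u) u.differentiable.continuous.aestronglyMeasurable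
    rw [eLpNorm_one_eq_lintegral_enorm, Measure.restrict_apply_univ] at ha
    have hb : eLpNorm u 2 (volume.restrict K) ≤ c ^ (1 / 2 : ℝ) * eLpNorm u 2 (weightMeasure Φ) := by
      refine (eLpNorm_mono_measure _ hle).trans (le_of_eq ?_)
      rw [eLpNorm_smul_measure_of_ne_top (by norm_num)]
      simp
    refine ha.trans ?_
    have he : (1 / (1 : ENNReal).toReal - 1 / (2 : ENNReal).toReal) = (1 / 2 : ℝ) := by norm_num
    rw [he]
    refine (mul_le_mul_left hb _).trans (le_of_eq ?_)
    simp only [D]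
    ring
  have h3 : ‖u x‖ₑ ≤ D / V * eLpNorm u 2 (weightMeasure Φ) := by
    rw [← ENNReal.mul_div_right_comm, ENNReal.le_div_iff_mul_le (Or.inl hV0) (Or.inl hVt)]
    exact (enorm_mul_volume_le u.differentiable x).trans (h1.trans h2)
  have h4 := ENNReal.toReal_mono (ENNReal.mul_ne_top (ENNReal.div_ne_top hD hV0) u.memLp.2.ne) h3
  rwa [ENNReal.toReal_mul, ← norm_eq, toReal_enorm] at h4

/-- Cauchy estimate for the differential of an entire function. -/
theorem norm_fderiv_le {u : (Fin n → ℂ) → ℂ} (hu : Differentiable ℂ u) (x : Fin n → ℂ) {C : ℝ}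
    (hC : ∀ y ∈ closedBall x 1, ‖u y‖ ≤ C) : ‖fderiv ℂ u x‖ ≤ C := by
  have hC0 : 0 ≤ C := (norm_nonneg _).trans (hC x (mem_closedBall_self zero_le_one))
  refine ContinuousLinearMap.opNorm_le_of_ball one_pos hC0 fun v _ => ?_
  by_cases hv : v = 0
  · simp [hv]
  have hv' : 0 < ‖v‖ := norm_pos_iff.2 hv
  have hline : Differentiable ℂ fun t : ℂ => x + t • v :=
    (differentiable_const x).add (differentiable_id.smul_const v)
  have hd : HasDerivAt (fun t : ℂ => u (x + t • v)) (fderiv ℂ u x v) 0 := by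
    have h1 : HasDerivAt (fun t : ℂ => x + t • v) v 0 := by
      simpa using ((hasDerivAt_id (0 : ℂ)).smul_const v).const_add x
    have h2 : HasFDerivAt u (fderiv ℂ u x) (x + (0 : ℂ) • v) := by
      simpa using (hu x).hasFDerivAt
    exact h2.comp_hasDerivAt 0 h1
  have h := Complex.norm_deriv_le_of_forall_mem_sphere_norm_le (c := 0) (R := ‖v‖⁻¹) (C := C)
    (f := fun t : ℂ => u (x + t • v)) (by positivity) (hu.comp hline).diffContOnCl fun t ht => by
      refine hC _ ?_
      rw [mem_sphere, dist_zero_right] at ht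
      rw [mem_closedBall, dist_eq_norm, add_sub_cancel_left, norm_smul, ht,
        inv_mul_cancel₀ hv'.ne']
  rw [hd.deriv, div_inv_eq_mul] at h
  exact h

/-- `H_Φ` is a Hilbert space. -/
instance : CompleteSpace (BargmannSpace Φ) := by
  refine Metric.complete_of_cauchySeq_tendsto fun U hU => ?_
  have hsub : ∀ R : ℝ, ∀ ε > 0, ∃ N, ∀ k ≥ N, ∀ l ≥ N, ∀ x ∈ closedBall (0 : Fin n → ℂ) R,
      ‖U k x - U l x‖ < ε := by
    intro R ε hε
    obtain ⟨C, hC0, hC⟩ := exists_bound Φ R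
    obtain ⟨N, hN⟩ := Metric.cauchySeq_iff.1 hU (ε / (C + 1)) (by positivity)
    refine ⟨N, fun k hk l hl x hx => ?_⟩
    have h1 := hC (U k - U l) x hx
    have h2 := hN k hk l hl
    rw [dist_eq_norm, lt_div_iff₀ (by positivity)] at h2
    rw [sub_apply] at h1
    nlinarith [norm_nonneg (U k - U l)]
  have hder : ∀ R : ℝ, ∀ ε > 0, ∃ N, ∀ k ≥ N, ∀ l ≥ N, ∀ x ∈ closedBall (0 : Fin n → ℂ) R,
      ‖fderiv ℂ (U k) x - fderiv ℂ (U l) x‖ ≤ ε := by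
    intro R ε hε
    obtain ⟨N, hN⟩ := hsub (R + 1) ε hε
    refine ⟨N, fun k hk l hl x hx => ?_⟩
    rw [← fderiv_sub (U k).differentiable.differentiableAt (U l).differentiable.differentiableAt]
    refine norm_fderiv_le ((U k).differentiable.sub (U l).differentiable) x fun y hy => ?_
    refine (hN k hk l hl y ?_).le
    rw [mem_closedBall] at hx hy ⊢
    linarith [dist_triangle y x 0]
  have hlim : ∀ x, ∃ y, Tendsto (fun k => U k x) atTop (𝓝 y) := fun x =>
    cauchySeq_tendsto_of_complete <| Metric.cauchySeq_iff.2 fun ε hε => by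
      obtain ⟨N, hN⟩ := hsub ‖x‖ ε hε
      exact ⟨N, fun k hk l hl => by
        rw [dist_eq_norm]; exact hN k hk l hl x (by simp)⟩
  have hlimd : ∀ x, ∃ y, Tendsto (fun k => fderiv ℂ (U k) x) atTop (𝓝 y) := fun x =>
    cauchySeq_tendsto_of_complete <| Metric.cauchySeq_iff.2 fun ε hε => by
      obtain ⟨N, hN⟩ := hder ‖x‖ (ε / 2) (by positivity)
      exact ⟨N, fun k hk l hl => by
        rw [dist_eq_norm]
        exact (hN k hk l hl x (by simp)).trans_lt (by linarith)⟩
  choose g hg using hlim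
  choose g' hg' using hlimd
  have hdiff : Differentiable ℂ g := by
    intro x
    have hx : x ∈ ball (0 : Fin n → ℂ) (‖x‖ + 1) := by simp
    refine (hasFDerivAt_of_tendstoUniformlyOn (l := atTop) (f := fun k => U k)
      (f' := fun k => fderiv ℂ (U k)) (g' := g') isOpen_ball ?_
      (fun k y _ => ((U k).differentiable y).hasFDerivAt) (fun y _ => hg y) hx).differentiableAt
    refine UniformCauchySeqOn.tendstoUniformlyOn_of_tendsto ?_ fun y _ => hg' y
    refine Metric.uniformCauchySeqOn_iff.2 fun ε hε => ?_
    obtain ⟨N, hN⟩ := hder (‖x‖ + 1) (ε / 2) (by positivity)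
    refine ⟨N, fun k hk l hl y hy => ?_⟩
    rw [dist_eq_norm]
    exact (hN k hk l hl y (ball_subset_closedBall hy)).trans_lt (by linarith)
  have hcL : CauchySeq fun k => toL2 Φ (U k) := (toL2 Φ).isometry.uniformContinuous.comp_cauchySeq hU
  obtain ⟨F, hF⟩ := cauchySeq_tendsto_of_complete hcL
  obtain ⟨φ, hφ, hae⟩ := (tendstoInMeasure_of_tendsto_Lp hF).exists_seq_tendsto_ae
  have hgF : g =ᵐ[weightMeasure Φ] F := by
    have hall : ∀ᵐ x ∂(weightMeasure Φ), ∀ k, toL2 Φ (U k) x = U k x :=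
      ae_all_iff.2 fun k => (U k).memLp.coeFn_toLp
    filter_upwards [hae, hall] with x hx hx2
    simp only [hx2] at hx
    exact tendsto_nhds_unique ((hg x).comp hφ.tendsto_atTop) hx
  have hgL : MemLp g 2 (weightMeasure Φ) := (memLp_congr_ae hgF).2 (Lp.memLp F)
  let G : BargmannSpace Φ := (⟨g, ⟨hdiff, hgL⟩⟩ : bargmannSubmodule Φ)
  have hG : toL2 Φ G = F := Lp.ext (hgL.coeFn_toLp.trans hgF)
  refine ⟨G, ?_⟩
  clear_value G
  rw [(toL2 Φ).isometry.isUniformInducing.isInducing.tendsto_nhds_iff, hG]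
  exact hF

end BargmannSpace

/-! ## Fourier integral operators in the complex domain -/

section Phase

variable {n N : ℕ}

/-- The space `ℂⁿ_x × ℂⁿ_y × ℂᴺ_θ` on which phase functions live. A holomorphic quadratic form on
it is a `QuadraticForm ℂ (PhaseDomain n N)`. -/
abbrev PhaseDomain (n N : ℕ) : Type := (Fin n → ℂ) × (Fin n → ℂ) × (Fin N → ℂ)

/-- `φ'_x`. As above, `polar φ p v` is the derivative of the quadratic form `φ` at `p` in the
direction `v`. -/
def phaseGradX (φ : QuadraticForm ℂ (PhaseDomain n N)) (p : PhaseDomain n N) : Fin n → ℂ :=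
  fun j => QuadraticMap.polar φ p (Pi.single j 1, 0, 0)

/-- `φ'_y`. -/
def phaseGradY (φ : QuadraticForm ℂ (PhaseDomain n N)) (p : PhaseDomain n N) : Fin n → ℂ :=
  fun j => QuadraticMap.polar φ p (0, Pi.single j 1, 0)

/-- `φ'_θ`. -/
def phaseGradTheta (φ : QuadraticForm ℂ (PhaseDomain n N)) (p : PhaseDomain n N) : Fin N → ℂ :=
  fun j => QuadraticMap.polar φ p (0, 0, Pi.single j 1)

/-- Non-degeneracy in the sense of Hörmander: the `N × (2n + N)` matrix
`(φ''_θx φ''_θy φ''_θθ)` has rank `N`. It is the matrix of the linear map `φ'_θ`, so this says that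
`φ'_θ` is onto `ℂᴺ`. -/
def IsNondegeneratePhase (φ : QuadraticForm ℂ (PhaseDomain n N)) : Prop :=
  Function.Surjective (phaseGradTheta φ)

/-- `φ` generates the graph of `κ`: the graph
`κ : (y, -φ'_y(x, y, θ)) ↦ (x, φ'_x(x, y, θ))`, `φ'_θ(x, y, θ) = 0`. -/
def Generates (φ : QuadraticForm ℂ (PhaseDomain n N))
    (κ : PhaseSpace n →ₗ[ℂ] PhaseSpace n) : Prop :=
  ∀ ρ μ : PhaseSpace n, κ ρ = μ ↔ ∃ x y θ, phaseGradTheta φ (x, y, θ) = 0 ∧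
    ρ = (y, -phaseGradY φ (x, y, θ)) ∧ μ = (x, phaseGradX φ (x, y, θ))

/-- The `y`-component of a point of `ℂⁿ_y × ℂᴺ_θ`. -/
def yPart (z : Fin n ⊕ Fin N → ℂ) : Fin n → ℂ := fun j => z (Sum.inl j)

/-- The `θ`-component of a point of `ℂⁿ_y × ℂᴺ_θ`. -/
def thetaPart (z : Fin n ⊕ Fin N → ℂ) : Fin N → ℂ := fun j => z (Sum.inr j)

/-- The plurisubharmonic function `(y, θ) ↦ -Im φ(x, y, θ) + Φ(y)`. -/
noncomputable def phaseWeight (φ : QuadraticForm ℂ (PhaseDomain n N))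
    (Φ : QuadraticForm ℝ (Fin n → ℂ)) (x : Fin n → ℂ) (z : Fin n ⊕ Fin N → ℂ) : ℝ :=
  -(φ (x, yPart z, thetaPart z)).im + Φ (yPart z)

end Phase

/-- The point with parameter `t ∈ ℝᵐ` of the oriented real affine subspace
`{c + M t : t ∈ ℝᵐ}` of `ℂᵐ`, where `M` is a complex `m × m` matrix. -/
def contourPoint {m : Type*} [Fintype m] (c : m → ℂ) (M : Matrix m m ℂ) (t : m → ℝ) : m → ℂ :=
  c + M.mulVec fun i => (t i : ℂ)

/-- The affine subspace `{c + M t : t ∈ ℝᵐ}` is a good contour for `f : ℂᵐ → ℝ`: it has real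
dimension `m`, it passes through a critical point `c` of `f`, and along it
`f ≤ f(c) - dist(·, c)² / C` for some `C > 0`. -/
structure IsGoodContour {m : Type*} [Fintype m] (f : (m → ℂ) → ℝ) (c : m → ℂ)
    (M : Matrix m m ℂ) : Prop where
  critical : HasFDerivAt f (0 : (m → ℂ) →L[ℝ] ℝ) c
  dimension : Function.Injective (contourPoint c M)
  decay : ∃ C : ℝ, 0 < C ∧
    ∀ t, f (contourPoint c M t) ≤ f c - 1 / C * dist (contourPoint c M t) c ^ 2

/-- The integral of the holomorphic form `g dz₁ ∧ ⋯ ∧ dz_m` over the contour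
`{c + M t : t ∈ ℝᵐ}`; the form pulls back to `g(c + M t) det M dt₁ ∧ ⋯ ∧ dt_m`. -/
noncomputable def contourIntegral {m : Type*} [Fintype m] [DecidableEq m] (c : m → ℂ)
    (M : Matrix m m ℂ) (g : (m → ℂ) → ℂ) : ℂ :=
  M.det * ∫ t : m → ℝ, g (contourPoint c M t)

/-- `A : H_{Φ₁} → H_{Φ₂}` is a realization of a metaplectic Fourier integral operator associated
to the complex linear canonical transformation `κ`: for a non-degenerate quadratic phase function
`φ` generating the graph of `κ`, a constant amplitude `a`, and good contours `Γ(x)` for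
`(y, θ) ↦ -Im φ(x, y, θ) + Φ₁(y)`,
`A u(x) = ∬_{Γ(x)} e^{iφ(x, y, θ)} a u(y) dy dθ`. -/
def IsFourierIntegralOperator {n : ℕ} {Φ₁ Φ₂ : QuadraticForm ℝ (Fin n → ℂ)}
    (κ : PhaseSpace n →ₗ[ℂ] PhaseSpace n) (A : BargmannSpace Φ₁ →L[ℂ] BargmannSpace Φ₂) : Prop :=
  IsCanonical κ ∧
  ∃ (N : ℕ) (φ : QuadraticForm ℂ (PhaseDomain n N)) (a : ℂ)
    (c : (Fin n → ℂ) → Fin n ⊕ Fin N → ℂ)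
    (M : (Fin n → ℂ) → Matrix (Fin n ⊕ Fin N) (Fin n ⊕ Fin N) ℂ),
    IsNondegeneratePhase φ ∧ Generates φ κ ∧
    (∀ x, IsGoodContour (phaseWeight φ Φ₁ x) (c x) (M x)) ∧
    ∀ (u : BargmannSpace Φ₁) (x : Fin n → ℂ),
      A u x = contourIntegral (c x) (M x) fun z =>
        Complex.exp (Complex.I * φ (x, yPart z, thetaPart z)) * a * u (yPart z)

/-! The space H_Φ has the Gaussian reproducing kernel k_y(z) = c exp(2Φ(z, ȳ)), where Φ(z, ω) is the
polarization of Φ (`IsHessianPair.exists_reproducing`). Hence A*v(y) = (k_y, A*v) = (A k_y, v), and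
the functions A k_y determine both A and A*. The contour integral that defines A k_y(x) is Gaussian,
so stationary phase is exact: A k_y(x) = C exp(q(x, ȳ)) with q a holomorphic quadratic form, and the
critical point equations say that q generates κ (`IsFourierIntegralOperator.exists_kernel`).
Therefore A* is integration against conj(C) exp(q*(y, x̄)) e^{-2Φ₂(x)}, where q*(y, x̄) is the
conjugate of q(x, ȳ).

Phase space has linear coordinates (z, ω), given by `polarPoint`, in which Λ_Φ is ω = z̄ and ι_Φ is
(z, ω) ↦ (ω̄, z̄). Passing from q to q* exchanges and conjugates the two variables, which turns the
generated map κ into ι₁ ∘ κ⁻¹ ∘ ι₂ (`IsKernelRelation.adjoint`).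

An integral operator with Gaussian kernel is a contour integral over θ = ȳ for the phase -i(q(x, θ)
- 2Φ(y, θ)). For A* this contour is good provided Re q(x, 0) < Φ₂(x) for x ≠ 0, and this is where
positivity of κ enters (`IsKernelRelation.re_lt_of_isPositiveRel`).

Uniqueness holds because a non-zero Gaussian determines its exponent (`eq_of_exp_quadExponent_eq`)
and the exponent determines the canonical transformation (`IsKernelRelation.unique`). -/

/-! ## Quadratic inequalities -/

/-- A positive continuous function, homogeneous of degree two, dominates the square of the norm. -/
theorem exists_pos_mul_sq_norm_le {E : Type*} [NormedAddCommGroup E] [NormedSpace ℝ E]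
    [FiniteDimensional ℝ E] {q : E → ℝ} (hq : Continuous q)
    (hom : ∀ (r : ℝ) x, q (r • x) = r ^ 2 * q x) (hpos : ∀ x, x ≠ 0 → 0 < q x) :
    ∃ δ : ℝ, 0 < δ ∧ ∀ x, δ * ‖x‖ ^ 2 ≤ q x := by
  have := FiniteDimensional.proper_real E
  have h0 : q 0 = 0 := by simpa using hom 0 0
  -- The sphere is empty only if the space is zero, and then any constant works; otherwise the
  -- constant is the minimum on the sphere.
  obtain hS | hS := (sphere (0 : E) 1).eq_empty_or_nonempty
  · refine ⟨1, one_pos, fun x => ?_⟩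
    by_cases hx : x = 0
    · simp [hx, h0]
    · have : ‖x‖⁻¹ • x ∈ sphere (0 : E) 1 := by simp [norm_smul, norm_ne_zero_iff.2 hx]
      simp [hS] at this
  · obtain ⟨x₀, hx₀, hmin⟩ := (isCompact_sphere (0 : E) 1).exists_isMinOn hS hq.continuousOn
    refine ⟨q x₀, hpos x₀ (ne_zero_of_mem_unit_sphere (⟨x₀, hx₀⟩ : sphere (0 : E) 1)), fun x => ?_⟩
    by_cases hx : x = 0
    · simp [hx, h0]
    have hx' : ‖x‖ ≠ 0 := norm_ne_zero_iff.2 hx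
    have h1 : ‖x‖⁻¹ • x ∈ sphere (0 : E) 1 := by simp [norm_smul, hx']
    have h2 : q x₀ ≤ q (‖x‖⁻¹ • x) := hmin h1
    rw [hom, inv_pow, ← div_eq_inv_mul, le_div_iff₀ (by positivity)] at h2
    exact h2

/-! ## Symmetric matrices -/

section Matrices

open Matrix

variable {m : Type*} [Fintype m]

theorem dotProduct_mulVec_symm {m' R : Type*} [Fintype m'] [CommSemiring R] (S : Matrix m m' R)
    (x : m → R) (y : m' → R) : x ⬝ᵥ S *ᵥ y = y ⬝ᵥ Sᵀ *ᵥ x := by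
  rw [dotProduct_mulVec, ← mulVec_transpose, dotProduct_comm]

theorem mulVec_dotProduct_mulVec_mulVec {m₁ m₂ R : Type*} [Fintype m₁] [Fintype m₂]
    [CommSemiring R] (N : Matrix m m₁ R) (S : Matrix m m R) (N' : Matrix m m₂ R) (v : m₁ → R)
    (w : m₂ → R) : (N *ᵥ v) ⬝ᵥ S *ᵥ N' *ᵥ w = v ⬝ᵥ (Nᵀ * S * N') *ᵥ w := by
  rw [← mulVec_mulVec, ← mulVec_mulVec, dotProduct_comm, dotProduct_mulVec_symm N]

variable [DecidableEq m]

theorem exists_orthogonal_diagonalization {Y : Matrix m m ℝ} (hY : Yᵀ = Y) :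
    ∃ (V : Matrix m m ℝ) (μ : m → ℝ), Vᵀ * V = 1 ∧ Vᵀ * Y * V = diagonal μ := by
  have h : Y.IsHermitian := by rwa [IsHermitian, conjTranspose_eq_transpose_of_trivial]
  refine ⟨h.eigenvectorUnitary, h.eigenvalues, ?_, ?_⟩
  · rw [← conjTranspose_eq_transpose_of_trivial]
    exact Unitary.coe_star_mul_self h.eigenvectorUnitary
  · have := h.conjStarAlgAut_star_eigenvectorUnitary
    rw [Unitary.conjStarAlgAut_star_apply, star_eq_conjTranspose,
      conjTranspose_eq_transpose_of_trivial] at this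
    exact this

/-- Diagonalize by an orthogonal matrix and divide each eigenvector by the square root of its
eigenvalue. -/
theorem exists_congruent_one {X : Matrix m m ℝ} (hX : Xᵀ = X)
    (hpos : ∀ t, t ≠ 0 → 0 < t ⬝ᵥ X *ᵥ t) : ∃ T : Matrix m m ℝ, Tᵀ * X * T = 1 := by
  obtain ⟨V, l, hV, hd⟩ := exists_orthogonal_diagonalization hX
  have hl : ∀ i, 0 < l i := by
    intro i
    have h1 : V *ᵥ Pi.single i 1 ≠ 0 := by
      intro h
      have h2 := congrArg (fun w => (Vᵀ *ᵥ w) i) h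
      simp only [mulVec_mulVec, hV] at h2
      simp at h2
    have h2 := hpos _ h1
    rw [mulVec_dotProduct_mulVec_mulVec, hd] at h2
    simpa using h2
  refine ⟨V * diagonal fun i => (Real.sqrt (l i))⁻¹, ?_⟩
  rw [transpose_mul, diagonal_transpose]
  have : (diagonal fun i => (Real.sqrt (l i))⁻¹) * Vᵀ * X * (V * diagonal fun i => (Real.sqrt (l i))⁻¹)
      = (diagonal fun i => (Real.sqrt (l i))⁻¹) * (Vᵀ * X * V) *
        (diagonal fun i => (Real.sqrt (l i))⁻¹) := by
    simp only [Matrix.mul_assoc]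
  rw [this, hd, diagonal_mul_diagonal, diagonal_mul_diagonal, ← diagonal_one]
  congr 1
  funext i
  have h1 : Real.sqrt (l i) ≠ 0 := (Real.sqrt_pos.2 (hl i)).ne'
  have h2 := Real.mul_self_sqrt (hl i).le
  field_simp
  nlinarith [h2]

/-- A complex symmetric matrix whose real part is positive definite is diagonalized by a real
congruence. -/
theorem exists_real_congruence_diagonal {B : Matrix m m ℂ} (hB : Bᵀ = B)
    (hpos : ∀ t : m → ℝ, t ≠ 0 → 0 < ((fun i => (t i : ℂ)) ⬝ᵥ B *ᵥ fun i => (t i : ℂ)).re) :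
    ∃ (U : Matrix m m ℝ) (β : m → ℂ), U.det ≠ 0 ∧ (∀ j, 0 < (β j).re) ∧
      (U.map Complex.ofReal)ᵀ * B * U.map Complex.ofReal = diagonal β := by
  set X : Matrix m m ℝ := B.map Complex.re
  set Y : Matrix m m ℝ := B.map Complex.im
  have hBXY : B = X.map Complex.ofReal + Complex.I • Y.map Complex.ofReal := by
    ext i j
    simp [X, Y, mul_comm Complex.I, Complex.re_add_im]
  have hX : Xᵀ = X := by rw [← transpose_map, hB]
  have hY : Yᵀ = Y := by rw [← transpose_map, hB]
  obtain ⟨T, hT⟩ := exists_congruent_one hX fun t ht => by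
    refine (hpos t ht).trans_eq ?_
    simp [dotProduct, mulVec, X]
  have hT' : (Tᵀ * Y * T)ᵀ = Tᵀ * Y * T := by
    simp [transpose_mul, hY, Matrix.mul_assoc]
  -- Simultaneous diagonalization: `T` turns the real part into the identity, and the orthogonal `V`
  -- that diagonalizes the transformed imaginary part preserves the identity. Hence the diagonal
  -- entries are 1 + iμ.
  obtain ⟨V, μ, hV, hd⟩ := exists_orthogonal_diagonalization hT'
  have h1 : (T * V)ᵀ * X * (T * V) = 1 := by
    rw [transpose_mul, show Vᵀ * Tᵀ * X * (T * V) = Vᵀ * (Tᵀ * X * T) * V by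
      simp only [Matrix.mul_assoc], hT, Matrix.mul_one, hV]
  have h2 : (T * V)ᵀ * Y * (T * V) = diagonal μ := by
    rw [transpose_mul, ← hd]
    simp only [Matrix.mul_assoc]
  refine ⟨T * V, fun j => 1 + Complex.I * μ j, ?_, fun j => by simp, ?_⟩
  · intro h0
    have := congrArg det h1
    simp only [det_mul (M := (T * V)ᵀ * X), det_one] at this
    rw [h0, mul_zero] at this
    exact zero_ne_one this
  · have e1 : ((T * V)ᵀ * X * (T * V)).map Complex.ofReal = 1 := by
      rw [h1]; exact Matrix.map_one _ Complex.ofReal_zero Complex.ofReal_one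
    have e2 : ((T * V)ᵀ * Y * (T * V)).map Complex.ofReal = diagonal fun i => (μ i : ℂ) := by
      rw [h2, diagonal_map Complex.ofReal_zero]
    have hm : ∀ A B : Matrix m m ℝ, (A * B).map Complex.ofReal
        = A.map Complex.ofReal * B.map Complex.ofReal := fun A B =>
      Matrix.map_mul (f := Complex.ofRealHom)
    rw [hm, hm, transpose_map] at e1 e2
    rw [hBXY, Matrix.mul_add, Matrix.add_mul, Matrix.mul_smul, Matrix.smul_mul, e1, e2]
    ext i j
    by_cases h : i = j
    · subst h; simp
    · simp [h]

end Matrices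

/-! ## Gaussian integrals over contours -/

section Gaussian

open Matrix

variable {m : Type*} [Fintype m] [DecidableEq m]

theorem integral_eq_abs_det_smul_integral_mulVec {U : Matrix m m ℝ} (hU : U.det ≠ 0)
    (g : (m → ℝ) → ℂ) : ∫ t, g t = (|U.det| : ℝ) * ∫ s, g (U *ᵥ s) := by
  have hmap := Real.map_matrix_volume_pi_eq_smul_volume_pi hU
  have hemb : MeasurableEmbedding (toLin' U) := by
    have : Function.Injective (toLin' U) :=
      mulVec_injective_iff_isUnit.2 ((isUnit_iff_isUnit_det U).2 hU.isUnit)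
    exact ((toLin' U).continuous_of_finiteDimensional.measurableEmbedding this)
  have h := hemb.integral_map (μ := volume) g
  rw [hmap, integral_smul_measure, ENNReal.toReal_ofReal (abs_nonneg _), Complex.real_smul] at h
  simp only [toLin'_apply] at h
  rw [← h, ← mul_assoc, ← Complex.ofReal_mul, abs_inv, mul_inv_cancel₀ (abs_ne_zero.2 hU),
    Complex.ofReal_one, one_mul]

/-- The Gaussian integral over a contour on which the quadratic part of the exponent is negative is
a constant times the exponential of the critical value; the square of the constant does not depend
on the contour. -/
theorem exists_contourIntegral_gaussian {S M : Matrix m m ℂ} (hS : Sᵀ = S)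
    (hneg : ∀ t : m → ℝ, t ≠ 0 → ((M *ᵥ fun i => (t i : ℂ)) ⬝ᵥ S *ᵥ M *ᵥ fun i => (t i : ℂ)).re < 0) :
    S.det ≠ 0 ∧ ∃ G : ℂ, G ^ 2 * (-S).det = (2 * Real.pi) ^ Fintype.card m ∧
      ∀ b c w : m → ℂ, S *ᵥ w + b = 0 →
        contourIntegral c M (fun z => Complex.exp (1 / 2 * (z ⬝ᵥ S *ᵥ z) + b ⬝ᵥ z))
          = G * Complex.exp (1 / 2 * (b ⬝ᵥ w)) := by
  -- A real change of the parameter t splits the integral into one-dimensional Gaussians with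
  -- exponents -β_j s_j².
  obtain ⟨U, β, hU, hβ, hd⟩ := exists_real_congruence_diagonal
    (B := -((1 / 2 : ℂ) • (Mᵀ * S * M)))
    (by simp [transpose_mul, hS, Matrix.mul_assoc]) (fun t ht => by
      have h := hneg t ht
      rw [mulVec_dotProduct_mulVec_mulVec] at h
      rw [neg_mulVec, dotProduct_neg, smul_mulVec, dotProduct_smul, smul_eq_mul, Complex.neg_re]
      simp only [Complex.mul_re]
      norm_num
      linarith)
  set N : Matrix m m ℂ := M * U.map Complex.ofReal
  have hN : Nᵀ * S * N = diagonal fun j => -2 * β j := by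
    have : Nᵀ * S * N = (-2 : ℂ) • ((U.map Complex.ofReal)ᵀ * -((1 / 2 : ℂ) • (Mᵀ * S * M))
        * U.map Complex.ofReal) := by
      simp only [N, transpose_mul, Matrix.mul_neg, Matrix.neg_mul, Matrix.mul_smul, Matrix.smul_mul,
        smul_neg, smul_smul, Matrix.mul_assoc]
      norm_num
    rw [this, hd, ← diagonal_smul]
    rfl
  have hβ0 : ∀ j, β j ≠ 0 := fun j h => by simpa [h] using hβ j
  have hdet : N.det ^ 2 * (-S).det = ∏ j, (2 * β j) := by
    have h1 : Nᵀ * -S * N = diagonal fun j => 2 * β j := by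
      rw [Matrix.mul_neg, Matrix.neg_mul, hN, diagonal_neg]
      simp
    have h2 := congrArg det h1
    rw [det_mul, det_mul, det_transpose, det_diagonal] at h2
    rw [sq, mul_right_comm, h2]
  have hprod : ∏ j, (2 * β j) ≠ 0 := Finset.prod_ne_zero_iff.2 fun j _ =>
    mul_ne_zero two_ne_zero (hβ0 j)
  have hN0 : N.det ≠ 0 := fun h => hprod (by rw [← hdet, h]; simp)
  have hS0 : (-S).det ≠ 0 := fun h => hprod (by rw [← hdet, h]; simp)
  refine ⟨fun h => hS0 (by rw [det_neg, h, mul_zero]),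
    M.det * (|U.det| : ℝ) * ∏ j, (Real.pi / β j) ^ (1 / 2 : ℂ), ?_, ?_⟩
  -- Squaring removes the absolute value of det U and the branch of the square roots; the β_j then
  -- cancel against det N² det(-S) = ∏ 2β_j.
  · have h1 : (M.det * ((|U.det| : ℝ) : ℂ)) ^ 2 = N.det ^ 2 := by
      have : (U.map Complex.ofReal).det = (U.det : ℂ) := (Complex.ofRealHom.map_det U).symm
      rw [det_mul, this, mul_pow, mul_pow, ← Complex.ofReal_pow, sq_abs, Complex.ofReal_pow]
    have h2 : (∏ j, ((Real.pi : ℂ) / β j) ^ (1 / 2 : ℂ)) ^ 2 = ∏ j, ((Real.pi : ℂ) / β j) := by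
      rw [← Finset.prod_pow]
      refine Finset.prod_congr rfl fun j _ => ?_
      rw [← Complex.cpow_nat_mul]
      norm_num
    rw [mul_pow, h1, h2, mul_right_comm, hdet, ← Finset.prod_mul_distrib]
    rw [Finset.prod_congr rfl fun j _ => (by
      have := hβ0 j
      field_simp : 2 * β j * ((Real.pi : ℂ) / β j) = 2 * Real.pi)]
    simp
  · intro b c w hw
    -- The complex displacement of the base point `c` from the critical point `w`, in the
    -- coordinates s. It adds a linear term to the Gaussian and the factor exp(-∑ β_i e_i²), which
    -- the integral of the linear term cancels; so the result is independent of `c`.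
    set e : m → ℂ := N⁻¹ *ᵥ (c - w)
    have he : N *ᵥ e = c - w := by
      rw [mulVec_mulVec, Matrix.mul_nonsing_inv _ hN0.isUnit, one_mulVec]
    have key : ∀ s : m → ℝ, 1 / 2 * (contourPoint c M (U *ᵥ s) ⬝ᵥ S *ᵥ contourPoint c M (U *ᵥ s))
        + b ⬝ᵥ contourPoint c M (U *ᵥ s) = 
        (-∑ i, β i * (s i : ℂ) ^ 2 + ∑ i, (-2 * β i * e i) * s i) +
          (1 / 2 * (b ⬝ᵥ w) - ∑ i, β i * e i ^ 2) := by
      intro s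
      set v : m → ℂ := e + fun i => (s i : ℂ)
      have h1 : contourPoint c M (U *ᵥ s) = w + N *ᵥ v := by
        have : (fun i => ((U *ᵥ s) i : ℂ)) = U.map Complex.ofReal *ᵥ fun i => (s i : ℂ) := by
          funext i
          simp [mulVec, dotProduct]
        rw [contourPoint, this, mulVec_mulVec, mulVec_add, he]
        simp only [N]
        abel
      have h2 : (N *ᵥ v) ⬝ᵥ S *ᵥ N *ᵥ v = ∑ i, -2 * β i * v i ^ 2 := by
        rw [mulVec_dotProduct_mulVec_mulVec, hN, dotProduct]
        refine Finset.sum_congr rfl fun i _ => ?_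
        rw [mulVec_diagonal]
        ring
      have hb : b = -(S *ᵥ w) := (neg_eq_of_add_eq_zero_right hw).symm
      have h3 : ∀ z, b ⬝ᵥ z = -(w ⬝ᵥ S *ᵥ z) := fun z => by
        rw [hb, neg_dotProduct, dotProduct_mulVec_symm S w, hS, dotProduct_comm]
      have h5 : (N *ᵥ v) ⬝ᵥ S *ᵥ w = w ⬝ᵥ S *ᵥ N *ᵥ v := by rw [dotProduct_mulVec_symm, hS]
      rw [h1]
      generalize N *ᵥ v = p at h2 h5
      rw [mulVec_add, dotProduct_add, add_dotProduct, add_dotProduct, dotProduct_add, h2, h3, h3,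
        h5]
      have h4 : ∑ i, -2 * β i * v i ^ 2 = 2 * ((-∑ i, β i * (s i : ℂ) ^ 2
          + ∑ i, (-2 * β i * e i) * s i) - ∑ i, β i * e i ^ 2) := by
        rw [← Finset.sum_neg_distrib, ← Finset.sum_add_distrib, ← Finset.sum_sub_distrib,
          Finset.mul_sum]
        refine Finset.sum_congr rfl fun i _ => ?_
        simp only [v, Pi.add_apply]
        ring
      rw [h4]
      ring
    rw [contourIntegral, integral_eq_abs_det_smul_integral_mulVec hU]
    simp only [key, Complex.exp_add _ (1 / 2 * (b ⬝ᵥ w) - _)]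
    rw [integral_mul_const, GaussianFourier.integral_cexp_neg_sum_mul_add hβ,
      Finset.prod_mul_distrib, ← Complex.exp_sum, sub_eq_add_neg, Complex.exp_add (1 / 2 * _)]
    have h5 : ∑ i, (-2 * β i * e i) ^ 2 / (4 * β i) = ∑ i, β i * e i ^ 2 :=
      Finset.sum_congr rfl fun i _ => by
        have := hβ0 i
        field_simp
        ring
    rw [h5, Complex.exp_neg]
    have := Complex.exp_ne_zero (∑ i, β i * e i ^ 2)
    field_simp

end Gaussian

/-! ## The Hessian of a weight -/

section Hessian

open Matrix

variable {n : ℕ}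

/-- `P` and `L` are the holomorphic Hessian and the Levi matrix of the strictly plurisubharmonic
quadratic form `Φ`, that is `Φ(x) = Re (x · P x) + x · L x̄`. -/
structure IsHessianPair (Φ : QuadraticForm ℝ (Fin n → ℂ)) (P L : Matrix (Fin n) (Fin n) ℂ) :
    Prop where
  symm : Pᵀ = P
  herm : Lᴴ = L
  apply : ∀ x, Φ x = (x ⬝ᵥ P *ᵥ x).re + (x ⬝ᵥ L *ᵥ star x).re
  grad : ∀ x, holGrad Φ x = P *ᵥ x + L *ᵥ star x
  pos : ∀ x, x ≠ 0 → 0 < (x ⬝ᵥ L *ᵥ star x).re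

/-- The matrices are P = ∂²Φ/∂x∂x and L = ∂²Φ/∂x∂x̄, written through the polar form on the real
basis e_j, i e_j. The formula for Φ is Euler's identity, and in Φ(x) + Φ(ix) the pluriharmonic part
Re(x · P x) cancels, so L is positive. -/
theorem exists_isHessianPair {Φ : QuadraticForm ℝ (Fin n → ℂ)} (hΦ : StrictlyPlurisubharmonic Φ) :
    ∃ P L, IsHessianPair Φ P L := by
  set e : Fin n → Fin n → ℂ := fun j => Pi.single j 1
  set f : Fin n → Fin n → ℂ := fun j => Pi.single j Complex.I
  set b : (Fin n → ℂ) → (Fin n → ℂ) → ℝ := QuadraticMap.polar Φ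
  have hb : ∀ x y, b x y = b y x := fun x y => QuadraticMap.polar_comm Φ x y
  set P : Matrix (Fin n) (Fin n) ℂ := fun j k =>
    ((b (e k) (e j) - b (f k) (f j) : ℝ) - Complex.I * (b (e k) (f j) + b (f k) (e j) : ℝ)) / 4
  set L : Matrix (Fin n) (Fin n) ℂ := fun j k =>
    ((b (e k) (e j) + b (f k) (f j) : ℝ) - Complex.I * (b (e k) (f j) - b (f k) (e j) : ℝ)) / 4
  have key : ∀ x w : Fin n → ℂ, b x w = ∑ k, ((x k).re * b (e k) w + (x k).im * b (f k) w) := by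
    intro x w
    have hw : x = ∑ j, ((x j).re • e j + (x j).im • f j) := by
      funext k
      simp only [Finset.sum_apply, Pi.add_apply, Pi.smul_apply, e, f, Pi.single_apply]
      rw [Finset.sum_eq_single k]
      · simp [Complex.re_add_im]
      · intro b _ hb
        simp [hb.symm]
      · simp
    conv_lhs => rw [hw]
    change QuadraticMap.polarBilin Φ _ w = _
    rw [map_sum, LinearMap.sum_apply]
    refine Finset.sum_congr rfl fun j _ => ?_
    rw [map_add, map_smul, map_smul]
    rfl
  have grad : ∀ x, holGrad Φ x = P *ᵥ x + L *ᵥ star x := by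
    intro x
    funext j
    simp only [holGrad, Pi.add_apply, mulVec, dotProduct, ← Finset.sum_add_distrib]
    change (((b x (e j) : ℝ) : ℂ) - Complex.I * ((b x (f j) : ℝ) : ℂ)) / 2 = _
    rw [key x (e j), key x (f j)]
    push_cast
    rw [Finset.mul_sum, ← Finset.sum_sub_distrib, Finset.sum_div]
    refine Finset.sum_congr rfl fun k _ => ?_
    have h1 : x k = (x k).re + (x k).im * Complex.I := (Complex.re_add_im _).symm
    have h2 : star x k = (x k).re - (x k).im * Complex.I := by
      rw [Pi.star_apply]
      apply Complex.ext <;> simp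
    rw [h2]
    conv_rhs => enter [1, 2]; rw [h1]
    simp only [P, L]
    push_cast
    linear_combination ((1 / 2 : ℂ) * (x k).im * b (f k) (e j)) * Complex.I_sq
  have symm : Pᵀ = P := by
    ext j k
    rw [transpose_apply]
    change (((b (e j) (e k) - b (f j) (f k) : ℝ) : ℂ)
        - Complex.I * (b (e j) (f k) + b (f j) (e k) : ℝ)) / 4
      = ((b (e k) (e j) - b (f k) (f j) : ℝ) - Complex.I * (b (e k) (f j) + b (f k) (e j) : ℝ)) / 4
    rw [hb (e j), hb (f j), hb (e j) (f k), hb (f j) (e k)]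
    push_cast
    ring
  have apply : ∀ x, Φ x = (x ⬝ᵥ P *ᵥ x).re + (x ⬝ᵥ L *ᵥ star x).re := by
    intro x
    have h := congrArg Complex.re (sum_holGrad_mul Φ x x)
    rw [QuadraticMap.polar_self, grad] at h
    rw [← Complex.add_re, ← dotProduct_add, dotProduct_comm, dotProduct]
    simp at h
    simp
    linarith
  refine ⟨P, L, symm, ?_, apply, grad, fun x hx => ?_⟩
  · ext j k
    rw [conjTranspose_apply]
    change star ((((b (e j) (e k) + b (f j) (f k) : ℝ) : ℂ)
        - Complex.I * (b (e j) (f k) - b (f j) (e k) : ℝ)) / 4)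
      = ((b (e k) (e j) + b (f k) (f j) : ℝ) - Complex.I * (b (e k) (f j) - b (f k) (e j) : ℝ)) / 4
    rw [hb (e j), hb (f j), hb (e j) (f k), hb (f j) (e k)]
    apply Complex.ext <;> simp
  · have h := hΦ x hx
    rw [apply, apply, star_smul, mulVec_smul, mulVec_smul, smul_dotProduct, smul_dotProduct,
      dotProduct_smul, dotProduct_smul, smul_smul, smul_smul] at h
    simp at h
    linarith

/-- The point of phase space over `z` with momentum `(2/i) ∂₁Φ(z, ω)`, where
`Φ(z, ω) = (z · P z) / 2 + z · L ω + (ω · P̄ ω) / 2` is the polarization of `Φ`. -/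
noncomputable def polarPoint (P L : Matrix (Fin n) (Fin n) ℂ) (z ω : Fin n → ℂ) : PhaseSpace n :=
  (z, (2 / Complex.I) • (P *ᵥ z + L *ᵥ ω))

theorem sympForm_eq (μ ν : PhaseSpace n) : sympForm μ ν = μ.2 ⬝ᵥ ν.1 - μ.1 ⬝ᵥ ν.2 := by
  simp [sympForm, dotProduct]

namespace IsHessianPair

variable {Φ : QuadraticForm ℝ (Fin n → ℂ)} {P L : Matrix (Fin n) (Fin n) ℂ}

theorem star_mulVec_levi (h : IsHessianPair Φ P L) (x : Fin n → ℂ) :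
    star (L *ᵥ x) = Lᵀ *ᵥ star x := by
  rw [star_mulVec, h.herm, mulVec_transpose]

theorem conj_levi (h : IsHessianPair Φ P L) (x y : Fin n → ℂ) :
    conj (x ⬝ᵥ L *ᵥ star y) = y ⬝ᵥ L *ᵥ star x := by
  rw [starRingEnd_apply, ← star_dotProduct_star, h.star_mulVec_levi, star_star,
    dotProduct_mulVec_symm L, dotProduct_comm]

theorem injective_levi (h : IsHessianPair Φ P L) : Function.Injective (L *ᵥ ·) := by
  intro x y hxy
  by_contra hne
  have h1 := h.pos (star (x - y)) (by simpa [sub_eq_zero] using hne)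
  simp only at hxy
  rw [star_star, mulVec_sub, hxy, sub_self] at h1
  simp at h1

theorem isUnit_levi (h : IsHessianPair Φ P L) : IsUnit L :=
  mulVec_injective_iff_isUnit.1 h.injective_levi

theorem det_levi_ne_zero (h : IsHessianPair Φ P L) : L.det ≠ 0 :=
  ((isUnit_iff_isUnit_det L).1 h.isUnit_levi).ne_zero

/-- Since L is invertible, (z, ω) are linear coordinates on the whole phase space. -/
theorem exists_polarPoint (h : IsHessianPair Φ P L) (ρ : PhaseSpace n) :
    ∃ z ω, ρ = polarPoint P L z ω := by
  refine ⟨ρ.1, L⁻¹ *ᵥ ((Complex.I / 2) • ρ.2 - P *ᵥ ρ.1), ?_⟩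
  rw [polarPoint, mulVec_mulVec, mul_nonsing_inv _ h.det_levi_ne_zero.isUnit, one_mulVec,
    add_sub_cancel, smul_smul, div_mul_div_comm, mul_comm Complex.I 2, div_self (by simp), one_smul]

/-- Points with ω = z̄ form Λ_Φ and are fixed. Any (z, ω) is (a, ā) + i(b, b̄), and antilinearity
sends it to (a, ā) - i(b, b̄). -/
theorem reflection_polarPoint (h : IsHessianPair Φ P L) (hΦ : StrictlyPlurisubharmonic Φ)
    (z ω : Fin n → ℂ) :
    reflection hΦ (polarPoint P L z ω) = polarPoint P L (star ω) (star z) := by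
  have hfix : ∀ x, reflection hΦ (polarPoint P L x (star x)) = polarPoint P L x (star x) :=
    fun x => (isReflection_reflection hΦ).2 _ ⟨x, by rw [polarPoint, ← h.grad]⟩
  have hlin : ∀ (c : ℂ) (z ω z' ω' : Fin n → ℂ), polarPoint P L (z + c • z') (ω + c • ω')
      = polarPoint P L z ω + c • polarPoint P L z' ω' := by
    intro c z ω z' ω'
    simp only [polarPoint, mulVec_add, mulVec_smul, Prod.smul_mk, Prod.mk_add_mk, Prod.mk.injEq,
      true_and]
    module
  set a : Fin n → ℂ := (1 / 2 : ℂ) • (z + star ω)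
  set b : Fin n → ℂ := (1 / (2 * Complex.I) : ℂ) • (z - star ω)
  have hI : Complex.I * (1 / (2 * Complex.I)) = 1 / 2 := by field_simp
  have hz : z = a + Complex.I • b := by
    simp only [a, b, smul_smul, hI]
    module
  have hω' : star ω = a - Complex.I • b := by
    simp only [a, b, smul_smul, hI]
    module
  have hω : ω = star a + Complex.I • star b := by
    rw [← star_star ω, hω', star_sub, star_smul]
    simp
  have hz' : star z = star a - Complex.I • star b := by
    rw [hz, star_add, star_smul]
    simp [sub_eq_add_neg]
  rw [hω', hz', hz, hω, hlin, map_add, LinearMap.map_smulₛₗ, hfix, hfix, Complex.conj_I,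
    sub_eq_add_neg, sub_eq_add_neg, ← neg_smul, ← neg_smul, hlin]

theorem sympForm_polarPoint (h : IsHessianPair Φ P L) (z ω z' ω' : Fin n → ℂ) :
    sympForm (polarPoint P L z ω) (polarPoint P L z' ω')
      = (2 / Complex.I) * (z' ⬝ᵥ L *ᵥ ω - z ⬝ᵥ L *ᵥ ω') := by
  have : (P *ᵥ z) ⬝ᵥ z' = z ⬝ᵥ P *ᵥ z' := by
    rw [dotProduct_comm, dotProduct_mulVec_symm, h.symm]
  rw [sympForm_eq, polarPoint, polarPoint]
  simp only [smul_dotProduct, dotProduct_smul, add_dotProduct, dotProduct_add, this, smul_eq_mul,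
    dotProduct_comm (L *ᵥ ω)]
  ring

/-- In the coordinates (z, ω) this is the Hermitian symmetry of L; it amounts to σ being real on
Λ_Φ. -/
theorem sympForm_reflection (h : IsHessianPair Φ P L) (hΦ : StrictlyPlurisubharmonic Φ)
    (μ ν : PhaseSpace n) :
    sympForm (reflection hΦ μ) (reflection hΦ ν) = conj (sympForm μ ν) := by
  obtain ⟨z, ω, rfl⟩ := h.exists_polarPoint μ
  obtain ⟨z', ω', rfl⟩ := h.exists_polarPoint ν
  rw [h.reflection_polarPoint, h.reflection_polarPoint, h.sympForm_polarPoint,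
    h.sympForm_polarPoint, map_mul, map_sub]
  have h1 := h.conj_levi z' (star ω)
  have h2 := h.conj_levi z (star ω')
  rw [star_star] at h1 h2
  rw [h1, h2, map_div₀, Complex.conj_I, map_ofNat]
  field_simp
  ring

/-- Expansion of the Levi form of a difference. -/
theorem levi_sub (h : IsHessianPair Φ P L) (x y : Fin n → ℂ) :
    ((x - y) ⬝ᵥ L *ᵥ star (x - y)).re
      = (x ⬝ᵥ L *ᵥ star x).re - 2 * (x ⬝ᵥ L *ᵥ star y).re + (y ⬝ᵥ L *ᵥ star y).re := by
  have h1 : (y ⬝ᵥ L *ᵥ star x).re = (x ⬝ᵥ L *ᵥ star y).re := by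
    rw [← h.conj_levi, Complex.conj_re]
  rw [star_sub, mulVec_sub, sub_dotProduct, dotProduct_sub, dotProduct_sub]
  simp only [Complex.sub_re, h1]
  ring

theorem levi_nonneg (h : IsHessianPair Φ P L) (x : Fin n → ℂ) :
    0 ≤ (x ⬝ᵥ L *ᵥ star x).re := by
  by_cases hx : x = 0
  · simp [hx]
  · exact (h.pos x hx).le

/-- Positivity of a canonical transformation in terms of the Levi forms. -/
theorem levi_le_of_isPositiveRel {Φ₁ Φ₂ : QuadraticForm ℝ (Fin n → ℂ)}
    {P₁ L₁ P₂ L₂ : Matrix (Fin n) (Fin n) ℂ} (h₁ : IsHessianPair Φ₁ P₁ L₁)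
    (h₂ : IsHessianPair Φ₂ P₂ L₂) {hΦ₁ : StrictlyPlurisubharmonic Φ₁}
    {hΦ₂ : StrictlyPlurisubharmonic Φ₂} {κ : PhaseSpace n →ₗ[ℂ] PhaseSpace n}
    (hpos : IsPositiveRel hΦ₂ hΦ₁ κ) {z ω x τ : Fin n → ℂ}
    (hκ : κ (polarPoint P₁ L₁ z ω) = polarPoint P₂ L₂ x τ) :
    (z ⬝ᵥ L₁ *ᵥ star z).re + (star τ ⬝ᵥ L₂ *ᵥ τ).re
      ≤ (star ω ⬝ᵥ L₁ *ᵥ ω).re + (x ⬝ᵥ L₂ *ᵥ star x).re := by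
  -- In these coordinates (1/i) σ(ρ, ιρ) is twice the Levi form at z minus twice the Levi form at
  -- ω̄.
  have h := hpos (polarPoint P₁ L₁ z ω)
  rw [hκ, h₁.reflection_polarPoint, h₂.reflection_polarPoint, h₁.sympForm_polarPoint,
    h₂.sympForm_polarPoint, ← mul_sub, ← mul_assoc,
    show 1 / Complex.I * (2 / Complex.I) = ((-2 : ℝ) : ℂ) by
      rw [div_mul_div_comm, Complex.I_mul_I]; norm_num] at h
  have h' := (Complex.le_def.1 h).1
  rw [Complex.re_ofReal_mul] at h'
  simp only [Complex.zero_re, Complex.sub_re] at h'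
  linarith

end IsHessianPair

end Hessian

/-! ## Reproducing kernels -/

section Reproducing

open Matrix

variable {n : ℕ}

theorem integral_weightMeasure (Φ : QuadraticForm ℝ (Fin n → ℂ)) (f : (Fin n → ℂ) → ℂ) :
    ∫ x, f x ∂(weightMeasure Φ) = ∫ x, (Real.exp (-2 * Φ x) : ℂ) * f x := by
  rw [weightMeasure, integral_withDensity_eq_integral_toReal_smul
    (BargmannSpace.measurable_density Φ) (by simp)]
  simp only [ENNReal.toReal_ofReal (Real.exp_pos _).le, Complex.real_smul]

theorem integrable_weightMeasure_iff {Φ : QuadraticForm ℝ (Fin n → ℂ)} {f : (Fin n → ℂ) → ℂ} :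
    Integrable f (weightMeasure Φ) ↔ Integrable fun x => (Real.exp (-2 * Φ x) : ℂ) * f x := by
  rw [weightMeasure, integrable_withDensity_iff_integrable_smul'
    (BargmannSpace.measurable_density Φ) (by simp)]
  simp only [ENNReal.toReal_ofReal (Real.exp_pos _).le, Complex.real_smul]

theorem integrable_exp_neg_mul_sq_norm {δ : ℝ} (hδ : 0 < δ) :
    Integrable fun x : Fin n → ℂ => Real.exp (-(δ * ‖x‖ ^ 2)) := by
  -- The norm on ℂⁿ is the supremum norm, so ∑ ‖x_i‖² ≤ n ‖x‖²; the denominator n + 1 also covers n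
  -- = 0.
  set ε : ℝ := δ / (n + 1)
  have hε : 0 < ε := by positivity
  have h1 : Integrable fun z : ℂ => Real.exp (-(ε * ‖z‖ ^ 2)) := by
    have h := GaussianFourier.integrable_cexp_neg_mul_sq_norm_add (V := ℂ) (b := ε)
      (by simpa using hε) 0 0
    refine h.norm.congr (Filter.Eventually.of_forall fun z => ?_)
    simp only [Complex.norm_exp]
    congr 1
    simp [← Complex.ofReal_pow]
  have h2 : Integrable fun x : Fin n → ℂ => ∏ i, Real.exp (-(ε * ‖x i‖ ^ 2)) :=
    Integrable.fintype_prod (f := fun _ z => Real.exp (-(ε * ‖z‖ ^ 2))) fun _ => h1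
  refine h2.mono' (by fun_prop) (Filter.Eventually.of_forall fun x => ?_)
  rw [Real.norm_of_nonneg (Real.exp_pos _).le, ← Real.exp_sum, Real.exp_le_exp,
    Finset.sum_neg_distrib, neg_le_neg_iff, ← Finset.mul_sum]
  have h3 : ∑ i, ‖x i‖ ^ 2 ≤ n * ‖x‖ ^ 2 := by
    refine (Finset.sum_le_sum fun i _ => pow_le_pow_left₀ (norm_nonneg _) (norm_le_pi_norm x i) 2).trans ?_
    simp
  calc ε * ∑ i, ‖x i‖ ^ 2 ≤ ε * ((n + 1) * ‖x‖ ^ 2) := by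
        gcongr
        nlinarith [sq_nonneg ‖x‖]
    _ = δ * ‖x‖ ^ 2 := by simp only [ε]; field_simp

/-- Mean value property of entire functions with respect to a density that is invariant under
rotations. -/
theorem integral_mul_eq_of_rotation_invariant {F : (Fin n → ℂ) → ℂ} (hF : Differentiable ℂ F)
    {w : (Fin n → ℂ) → ℝ} (hw : Continuous w)
    (hinv : ∀ (c : ℂ) x, ‖c‖ = 1 → w (c • x) = w x)
    (hint : Integrable fun x => F x * w x) :
    ∫ x, F x * w x = F 0 * ∫ x, (w x : ℂ) := by
  set T : Measure ℝ := volume.restrict (Set.Ioc 0 (2 * Real.pi))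
  have hT : T.real Set.univ = 2 * Real.pi := by
    simp [T, Measure.real, Real.pi_pos.le]
  have hpi : ((2 * Real.pi : ℝ) : ℂ) ≠ 0 := by exact_mod_cast Real.two_pi_pos.ne'
  have hc : ∀ t, ‖circleMap 0 1 t‖ = 1 := fun t => by simp
  have hmp : ∀ t, MeasurePreserving (fun (x : Fin n → ℂ) => circleMap 0 1 t • x) volume volume :=
    fun t => volume_preserving_pi
      (f := fun _ => rotation ⟨circleMap 0 1 t, by simp [Submonoid.unitSphere]⟩)
      fun _ => (rotation _).measurePreserving
  have hemb : ∀ t, MeasurableEmbedding (fun (x : Fin n → ℂ) => circleMap 0 1 t • x) := fun t =>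
    (Homeomorph.smulOfNeZero (circleMap 0 1 t)
      (norm_ne_zero_iff.1 (by rw [hc]; exact one_ne_zero))).measurableEmbedding
  have hmv : ∀ x, ∫ t, F (circleMap 0 1 t • x) ∂T = F 0 * (2 * Real.pi : ℝ) := by
    intro x
    have hd : Differentiable ℂ fun z : ℂ => F (z • x) := hF.comp (differentiable_id.smul_const x)
    have h := (hd.diffContOnCl (s := ball 0 |1|)).circleAverage
    rw [Real.circleAverage_def, intervalIntegral.integral_of_le Real.two_pi_pos.le] at h
    simp only [zero_smul] at h
    rw [← h, Complex.real_smul, Complex.ofReal_inv]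
    field_simp
    rfl
  have hrot : ∀ t, ∫ x, F (circleMap 0 1 t • x) * w x = ∫ x, F x * w x := by
    intro t
    have h := (hmp t).integral_comp (hemb t) fun x => F x * w x
    simpa only [hinv _ _ (hc t)] using h
  -- Rotations do not change the integral of the norm, so each slice has the same norm integral and
  -- Fubini applies to the average over the circle.
  have hprod : Integrable (fun p : ℝ × (Fin n → ℂ) => F (circleMap 0 1 p.1 • p.2) * w p.2)
      (T.prod volume) := by
    have hcont : Continuous fun p : ℝ × (Fin n → ℂ) => F (circleMap 0 1 p.1 • p.2) * w p.2 :=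
      (hF.continuous.comp (((continuous_circleMap 0 1).comp continuous_fst).smul
        continuous_snd)).mul (Complex.continuous_ofReal.comp (hw.comp continuous_snd))
    rw [integrable_prod_iff hcont.aestronglyMeasurable]
    have hi : ∀ t, Integrable fun x => F (circleMap 0 1 t • x) * w x := fun t => by
      refine ((hmp t).integrable_comp_of_integrable hint).congr
        (Filter.Eventually.of_forall fun x => ?_)
      simp only [Function.comp_apply, hinv _ _ (hc t)]
    refine ⟨Filter.Eventually.of_forall hi, ?_⟩
    have : ∀ t, ∫ x, ‖F (circleMap 0 1 t • x) * w x‖ = ∫ x, ‖F x * w x‖ := by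
      intro t
      have h := (hmp t).integral_comp (hemb t) fun x => ‖F x * w x‖
      simpa only [hinv _ _ (hc t)] using h
    simp only [this]
    exact integrable_const _
  have hswap := integral_integral_swap (f := fun t x => F (circleMap 0 1 t • x) * w x) hprod
  simp only [hrot, integral_const, hT, integral_mul_const, hmv] at hswap
  rw [Complex.real_smul] at hswap
  rw [← integral_const_mul]
  have h2 : ∫ x, F 0 * (2 * Real.pi : ℝ) * (w x : ℂ) = (2 * Real.pi : ℝ) * ∫ x, F 0 * (w x : ℂ) := by
    rw [← integral_const_mul]
    refine integral_congr_ae (Filter.Eventually.of_forall fun x => ?_)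
    simp only
    ring
  rw [h2] at hswap
  exact mul_left_cancel₀ hpi hswap

namespace IsHessianPair

variable {Φ : QuadraticForm ℝ (Fin n → ℂ)} {P L : Matrix (Fin n) (Fin n) ℂ}

theorem star_mulVec_hess (h : IsHessianPair Φ P L) (x : Fin n → ℂ) :
    star (P *ᵥ x) = Pᴴ *ᵥ star x := by
  rw [star_mulVec, ← mulVec_transpose, conjTranspose, ← transpose_map, h.symm, h.symm]

theorem conj_hess (h : IsHessianPair Φ P L) (x : Fin n → ℂ) :
    conj (x ⬝ᵥ P *ᵥ x) = star x ⬝ᵥ Pᴴ *ᵥ star x := by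
  rw [starRingEnd_apply, ← star_dotProduct_star, h.star_mulVec_hess, dotProduct_comm]

theorem continuous_levi (L : Matrix (Fin n) (Fin n) ℂ) :
    Continuous fun x : Fin n → ℂ => (x ⬝ᵥ L *ᵥ star x).re := by
  fun_prop

theorem ofReal_levi (h : IsHessianPair Φ P L) (x : Fin n → ℂ) :
    (((x ⬝ᵥ L *ᵥ star x).re : ℝ) : ℂ) = x ⬝ᵥ L *ᵥ star x :=
  Complex.conj_eq_iff_re.1 (h.conj_levi x x)

theorem exists_pos_mul_sq_norm_le_levi (h : IsHessianPair Φ P L) :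
    ∃ δ : ℝ, 0 < δ ∧ ∀ x, δ * ‖x‖ ^ 2 ≤ (x ⬝ᵥ L *ᵥ star x).re := by
  refine exists_pos_mul_sq_norm_le (continuous_levi L) (fun r x => ?_) h.pos
  rw [star_smul, mulVec_smul, dotProduct_smul, smul_dotProduct, smul_smul]
  simp [sq]

theorem integrable_exp_levi (h : IsHessianPair Φ P L) :
    Integrable fun x : Fin n → ℂ => Real.exp (-2 * (x ⬝ᵥ L *ᵥ star x).re) := by
  obtain ⟨δ, hδ, hle⟩ := h.exists_pos_mul_sq_norm_le_levi
  refine (integrable_exp_neg_mul_sq_norm (δ := 2 * δ) (by positivity)).mono'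
    (by have := continuous_levi L; fun_prop) (Filter.Eventually.of_forall fun x => ?_)
  rw [Real.norm_of_nonneg (Real.exp_pos _).le, Real.exp_le_exp]
  linarith [hle x]

end IsHessianPair

/-- The quadratic exponent `x · R x + 2 x · K ω + ω · T ω`. The polarization of a weight is given by
`2 Φ(z, ω) = quadExponent P L Pᴴ z ω`. -/
def quadExponent (R K T : Matrix (Fin n) (Fin n) ℂ) (x ω : Fin n → ℂ) : ℂ :=
  x ⬝ᵥ R *ᵥ x + 2 * (x ⬝ᵥ K *ᵥ ω) + ω ⬝ᵥ T *ᵥ ω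

/-- Completing the square gives |k_y(z)|² e^{-2Φ(z)} = const · exp(-2 (z - y) · L (z - y)‾), hence
square integrability. Centred at y, the integrand of (k_y, u) is an entire function with value u(y)
at the centre, times the same density, which is invariant under rotations; the mean value property
then gives u(y). -/
theorem IsHessianPair.exists_reproducing {Φ : QuadraticForm ℝ (Fin n → ℂ)}
    {P L : Matrix (Fin n) (Fin n) ℂ} (h : IsHessianPair Φ P L) :
    ∃ (c : ℂ) (k : (Fin n → ℂ) → BargmannSpace Φ), 
      (∀ y z, k y z = c * Complex.exp (quadExponent P L Pᴴ z (star y))) ∧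
      ∀ y (u : BargmannSpace Φ), inner ℂ (k y) u = u y := by
  set J : ℝ := ∫ x : Fin n → ℂ, Real.exp (-2 * (x ⬝ᵥ L *ᵥ star x).re)
  -- The constant J⁻¹ normalizes the rotation invariant density to total mass one.
  have hJ : 0 < J := integral_exp_pos h.integrable_exp_levi
  have hdiff : ∀ y, Differentiable ℂ fun z : Fin n → ℂ =>
      (J⁻¹ : ℂ) * Complex.exp (quadExponent P L Pᴴ z (star y)) := by
    intro y
    simp only [quadExponent, dotProduct, mulVec]
    fun_prop
  have hnorm : ∀ y z : Fin n → ℂ, Real.exp (-2 * Φ z) * ‖(J⁻¹ : ℂ) * Complex.exp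
      (quadExponent P L Pᴴ z (star y))‖ ^ 2 = J⁻¹ ^ 2 * Real.exp (2 * Φ y) *
        Real.exp (-2 * ((z - y) ⬝ᵥ L *ᵥ star (z - y)).re) := by
    intro y z
    have h1 : (quadExponent P L Pᴴ z (star y)).re = (z ⬝ᵥ P *ᵥ z).re + 2 * (z ⬝ᵥ L *ᵥ star y).re
        + (y ⬝ᵥ P *ᵥ y).re := by
      rw [quadExponent, ← h.conj_hess]
      simp
    rw [norm_mul, Complex.norm_exp, h1, mul_pow, ← Complex.ofReal_inv, Complex.norm_real,
      Real.norm_of_nonneg (inv_nonneg.2 hJ.le), mul_left_comm, mul_assoc, ← Real.exp_nat_mul,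
      ← Real.exp_add, ← Real.exp_add, h.levi_sub, h.apply, h.apply]
    congr 2
    push_cast
    ring
  have hmem : ∀ y, MemLp (fun z : Fin n → ℂ => (J⁻¹ : ℂ) * Complex.exp
      (quadExponent P L Pᴴ z (star y))) 2 (weightMeasure Φ) := by
    intro y
    rw [memLp_two_iff_integrable_sq_norm (hdiff y).continuous.aestronglyMeasurable]
    rw [weightMeasure, integrable_withDensity_iff_integrable_smul'
      (BargmannSpace.measurable_density Φ) (by simp)]
    simp only [ENNReal.toReal_ofReal (Real.exp_pos _).le, smul_eq_mul, hnorm]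
    exact (h.integrable_exp_levi.comp_sub_right y).const_mul _
  have hex : ∀ y, ∃ k : BargmannSpace Φ,
      ∀ z, k z = (J⁻¹ : ℂ) * Complex.exp (quadExponent P L Pᴴ z (star y)) :=
    fun y => ⟨(⟨_, hdiff y, hmem y⟩ : bargmannSubmodule Φ), fun _ => rfl⟩
  choose k hk using hex
  refine ⟨(J⁻¹ : ℂ), k, hk, fun y u => ?_⟩
  set F : (Fin n → ℂ) → ℂ := fun ζ => u (y + ζ) *
    Complex.exp (-((y + ζ) ⬝ᵥ P *ᵥ (y + ζ)) + y ⬝ᵥ P *ᵥ y - 2 * (ζ ⬝ᵥ L *ᵥ star y))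
  have hF : Differentiable ℂ F := by
    refine (u.differentiable.comp (differentiable_id.const_add y)).mul ?_
    simp only [dotProduct, mulVec]
    fun_prop
  have key : ∀ ζ, (Real.exp (-2 * Φ (y + ζ)) : ℂ) * (conj (k y (y + ζ)) * u (y + ζ))
      = (J⁻¹ : ℂ) * (F ζ * (Real.exp (-2 * (ζ ⬝ᵥ L *ᵥ star ζ).re) : ℝ)) := by
    intro ζ
    have h1 : conj (quadExponent P L Pᴴ (y + ζ) (star y)) = conj ((y + ζ) ⬝ᵥ P *ᵥ (y + ζ))
        + 2 * (y ⬝ᵥ L *ᵥ star (y + ζ)) + y ⬝ᵥ P *ᵥ y := by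
      rw [quadExponent, ← h.conj_hess]
      simp only [map_add, map_mul, h.conj_levi, map_ofNat, Complex.conj_conj]
    have h2 : ((Φ (y + ζ) : ℝ) : ℂ) = ((y + ζ) ⬝ᵥ P *ᵥ (y + ζ) + conj ((y + ζ) ⬝ᵥ P *ᵥ (y + ζ))) / 2
        + (y + ζ) ⬝ᵥ L *ᵥ star (y + ζ) := by
      rw [h.apply, Complex.ofReal_add, h.ofReal_levi, Complex.re_eq_add_conj]
    rw [hk, map_mul, map_inv₀, Complex.conj_ofReal, ← Complex.exp_conj, h1, Complex.ofReal_exp,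
      Complex.ofReal_exp]
    push_cast
    rw [h2, h.ofReal_levi]
    simp only [F]
    rw [show ∀ a b c d : ℂ, a * (b * c * d) = b * (d * (a * c)) by intros; ring, mul_assoc (u _),
      ← Complex.exp_add, ← Complex.exp_add]
    congr 3
    simp only [star_add, mulVec_add, add_dotProduct, dotProduct_add]
    ring
  have hint : Integrable fun ζ => F ζ * ((Real.exp (-2 * (ζ ⬝ᵥ L *ᵥ star ζ).re) : ℝ) : ℂ) := by
    have h1 := (integrable_weightMeasure_iff.1 (BargmannSpace.integrable_inner (k y) u)).comp_add_left y
    simp only [key] at h1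
    have h2 := h1.const_mul (J : ℂ)
    refine h2.congr (Filter.Eventually.of_forall fun ζ => ?_)
    have : (J : ℂ) ≠ 0 := by exact_mod_cast hJ.ne'
    simp only
    rw [mul_inv_cancel_left₀ this]
  have hmean := integral_mul_eq_of_rotation_invariant hF
    (w := fun ζ => Real.exp (-2 * (ζ ⬝ᵥ L *ᵥ star ζ).re))
    (by have := IsHessianPair.continuous_levi L; fun_prop) (fun c x hc => by
      rw [star_smul, mulVec_smul, dotProduct_smul, smul_dotProduct, smul_smul]
      simp [Complex.conj_mul', hc]) hint
  rw [BargmannSpace.inner_def, integral_weightMeasure, ← integral_add_left_eq_self _ y]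
  simp only [key]
  rw [integral_const_mul, hmean, integral_complex_ofReal]
  have : (J : ℂ) ≠ 0 := by exact_mod_cast hJ.ne'
  change (J : ℂ)⁻¹ * (F 0 * (J : ℂ)) = _
  simp only [F]
  field_simp
  simp

end Reproducing

/-! ## The kernel of a Fourier integral operator -/

section Kernel

open Matrix

theorem QuadraticMap.map_add_add_map_sub {R M N : Type*} [CommRing R] [AddCommGroup M] [Module R M]
    [AddCommGroup N] [Module R N] (Q : QuadraticMap R M N) (x y : M) :
    Q (x + y) + Q (x - y) = 2 • Q x + 2 • Q y := by
  rw [sub_eq_add_neg, QuadraticMap.map_add Q x y, QuadraticMap.map_add Q x (-y),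
    QuadraticMap.polar_neg_right, QuadraticMap.map_neg]
  abel

variable {n N : ℕ}

/-- The point `(x, y, θ)` with `z = (y, θ)`. -/
def phasePoint (x : Fin n → ℂ) (z : Fin n ⊕ Fin N → ℂ) : PhaseDomain n N :=
  (x, yPart z, thetaPart z)

/-- `A`, `B`, `D` are the blocks of the Hessian of `φ` with respect to `x` and `z = (y, θ)`. -/
structure IsPhaseHessian (φ : QuadraticForm ℂ (PhaseDomain n N)) (A : Matrix (Fin n) (Fin n) ℂ)
    (B : Matrix (Fin n) (Fin n ⊕ Fin N) ℂ) (D : Matrix (Fin n ⊕ Fin N) (Fin n ⊕ Fin N) ℂ) :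
    Prop where
  symm_left : Aᵀ = A
  symm_right : Dᵀ = D
  apply : ∀ x z, φ (phasePoint x z) = 1 / 2 * (x ⬝ᵥ A *ᵥ x) + x ⬝ᵥ B *ᵥ z + 1 / 2 * (z ⬝ᵥ D *ᵥ z)
  gradX : ∀ x z, phaseGradX φ (phasePoint x z) = A *ᵥ x + B *ᵥ z
  gradY : ∀ x z, phaseGradY φ (phasePoint x z) = yPart (Bᵀ *ᵥ x + D *ᵥ z)
  gradTheta : ∀ x z, phaseGradTheta φ (phasePoint x z) = thetaPart (Bᵀ *ᵥ x + D *ᵥ z)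

theorem exists_isPhaseHessian (φ : QuadraticForm ℂ (PhaseDomain n N)) :
    ∃ A B D, IsPhaseHessian φ A B D := by
  set b := QuadraticMap.polarBilin φ
  have hb : ∀ p q, b p q = b q p := fun p q => QuadraticMap.polar_comm φ p q
  set e : Fin n → PhaseDomain n N := fun j => (Pi.single j 1, 0, 0)
  set f : Fin n ⊕ Fin N → PhaseDomain n N := fun i => phasePoint 0 (Pi.single i 1)
  set A : Matrix (Fin n) (Fin n) ℂ := Matrix.of fun j k => b (e j) (e k)
  set B : Matrix (Fin n) (Fin n ⊕ Fin N) ℂ := Matrix.of fun j i => b (e j) (f i)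
  set D : Matrix (Fin n ⊕ Fin N) (Fin n ⊕ Fin N) ℂ := Matrix.of fun i l => b (f i) (f l)
  have hp : ∀ x z, phasePoint x z = ∑ j, x j • e j + ∑ i, z i • f i := by
    intro x z
    refine Prod.ext ?_ (Prod.ext ?_ ?_)
    · funext k
      simp [phasePoint, e, f, Prod.fst_sum, Finset.sum_apply, Pi.single_apply]
    · funext k
      simp [phasePoint, e, f, Prod.fst_sum, Prod.snd_sum, Finset.sum_apply, Pi.single_apply, yPart]
    · funext k
      simp [phasePoint, e, f, Prod.snd_sum, Finset.sum_apply, Pi.single_apply, thetaPart]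
  have hbe : ∀ q x z, b q (phasePoint x z) = ∑ j, x j * b q (e j) + ∑ i, z i * b q (f i) := by
    intro q x z
    rw [hp, map_add, map_sum, map_sum]
    simp only [map_smul, smul_eq_mul]
  have hX : ∀ x z j, b (e j) (phasePoint x z) = (A *ᵥ x + B *ᵥ z) j := by
    intro x z j
    rw [hbe]
    simp [mulVec, dotProduct, A, B, mul_comm]
  have hZ : ∀ x z i, b (f i) (phasePoint x z) = (Bᵀ *ᵥ x + D *ᵥ z) i := by
    intro x z i
    rw [hbe]
    simp [mulVec, dotProduct, D, B, mul_comm, hb (f i) (e _)]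
  refine ⟨A, B, D, ?_, ?_, fun x z => ?_, fun x z => ?_, fun x z => ?_, fun x z => ?_⟩
  · ext j k
    exact hb _ _
  · ext j k
    exact hb _ _
  · have h1 : b (phasePoint x z) (phasePoint x z) = 2 * φ (phasePoint x z) := by
      change QuadraticMap.polar φ _ _ = _
      rw [QuadraticMap.polar_self]
      simp
    have h2 : b (phasePoint x z) (phasePoint x z)
        = x ⬝ᵥ (A *ᵥ x + B *ᵥ z) + z ⬝ᵥ (Bᵀ *ᵥ x + D *ᵥ z) := by
      rw [hbe]
      simp only [hb (phasePoint x z), hX, hZ]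
      rfl
    rw [dotProduct_add, dotProduct_add, dotProduct_mulVec_symm Bᵀ, transpose_transpose] at h2
    linear_combination (1 / 2 : ℂ) * h2 - (1 / 2 : ℂ) * h1
  · funext j
    rw [← hX, hb]
    rfl
  · funext j
    rw [yPart, ← hZ, hb]
    change b _ _ = b _ _
    congr 1
    refine Prod.ext rfl (Prod.ext ?_ ?_) <;> funext k <;>
      simp [f, phasePoint, yPart, thetaPart, Pi.single_apply]
  · funext j
    rw [thetaPart, ← hZ, hb]
    change b _ _ = b _ _
    congr 1
    refine Prod.ext rfl (Prod.ext ?_ ?_) <;> funext k <;>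
      simp [f, phasePoint, yPart, thetaPart, Pi.single_apply]

/-- The canonical transformation `κ` is generated by the kernel exponent `quadExponent R K T`
relative to the weight with Hessian pair `(P, L)`. -/
def IsKernelRelation (P L R K T : Matrix (Fin n) (Fin n) ℂ)
    (κ : PhaseSpace n →ₗ[ℂ] PhaseSpace n) : Prop :=
  ∀ z ω, ∃ x, Kᵀ *ᵥ x + T *ᵥ ω = Lᵀ *ᵥ z + Pᴴ *ᵥ ω ∧
    κ (polarPoint P L z ω) = polarPoint R K x ω

/-- The inclusion of `ℂⁿ_y` into `ℂⁿ_y × ℂᴺ_θ`. -/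
def yIncl (n N : ℕ) : Matrix (Fin n ⊕ Fin N) (Fin n) ℂ := fromRows 1 0

theorem yIncl_transpose_mulVec (z : Fin n ⊕ Fin N → ℂ) : (yIncl n N)ᵀ *ᵥ z = yPart z := by
  rw [yIncl, transpose_fromRows, fromCols_mulVec]
  simp
  rfl

theorem yPart_yIncl_mulVec (y : Fin n → ℂ) : yPart (yIncl n N *ᵥ y) = y := by
  rw [yIncl, fromRows_mulVec, one_mulVec]
  rfl

theorem thetaPart_yIncl_mulVec (y : Fin n → ℂ) : thetaPart (yIncl n N *ᵥ y) = 0 := by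
  rw [yIncl, fromRows_mulVec]
  funext j
  simp [thetaPart]

/-- The quadratic part of a phase weight is negative along a good contour. -/
theorem IsGoodContour.phase_neg {φ : QuadraticForm ℂ (PhaseDomain n N)}
    {Φ : QuadraticForm ℝ (Fin n → ℂ)} {x : Fin n → ℂ} {c : Fin n ⊕ Fin N → ℂ}
    {M : Matrix (Fin n ⊕ Fin N) (Fin n ⊕ Fin N) ℂ} (h : IsGoodContour (phaseWeight φ Φ x) c M)
    {t : Fin n ⊕ Fin N → ℝ} (ht : t ≠ 0) :
    phaseWeight φ Φ 0 (M *ᵥ fun i => (t i : ℂ)) < 0 := by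
  set v := M *ᵥ fun i => (t i : ℂ)
  have hv : v ≠ 0 := fun h0 => ht (h.dimension (by
    have : M *ᵥ (fun i => (((0 : Fin n ⊕ Fin N → ℝ) i : ℝ) : ℂ)) = 0 := by
      rw [← mulVec_zero M]
      congr 1
    rw [contourPoint, contourPoint, this]
    exact congrArg (c + ·) h0))
  have hplus : contourPoint c M t = c + v := rfl
  have hminus : contourPoint c M (-t) = c - v := by
    rw [contourPoint, sub_eq_add_neg, ← mulVec_neg]
    congr 2
    funext i
    simp
  -- The parallelogram law isolates the quadratic part of the weight, and the decay estimate applies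
  -- at both t and -t.
  have hsum : phaseWeight φ Φ x (c + v) + phaseWeight φ Φ x (c - v)
      = 2 * phaseWeight φ Φ x c + 2 * phaseWeight φ Φ 0 v := by
    have h1 := congrArg Complex.im (φ.map_add_add_map_sub (phasePoint x c) (phasePoint 0 v))
    have h2 := Φ.map_add_add_map_sub (yPart c) (yPart v)
    have e1 : phasePoint x c + phasePoint 0 v = (x, yPart (c + v), thetaPart (c + v)) := by
      simp [phasePoint]; exact ⟨rfl, rfl⟩
    have e2 : phasePoint x c - phasePoint 0 v = (x, yPart (c - v), thetaPart (c - v)) := by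
      simp [phasePoint]; exact ⟨rfl, rfl⟩
    have e3 : yPart c + yPart v = yPart (c + v) := rfl
    have e4 : yPart c - yPart v = yPart (c - v) := rfl
    rw [e1, e2] at h1
    rw [e3, e4] at h2
    simp [phasePoint] at h1 h2
    simp only [phaseWeight]
    linarith
  obtain ⟨C, hC, hdec⟩ := h.decay
  have h1 := hdec t
  have h2 := hdec (-t)
  rw [hplus, dist_eq_norm, add_sub_cancel_left] at h1
  rw [hminus, dist_eq_norm, sub_sub_cancel_left, norm_neg] at h2
  have h3 : 0 < 1 / C * ‖v‖ ^ 2 := by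
    have := norm_pos_iff.2 hv
    positivity
  linarith

/-- Against k_y the contour integral is Gaussian in (y, θ), and its critical value is a quadratic
form in x and ȳ. Being the critical value, it generates the same relation as the phase, once the
variables y, θ are eliminated. -/
theorem IsFourierIntegralOperator.exists_kernel {Φ₁ Φ₂ : QuadraticForm ℝ (Fin n → ℂ)}
    {P₁ L₁ : Matrix (Fin n) (Fin n) ℂ} (h₁ : IsHessianPair Φ₁ P₁ L₁)
    {κ : PhaseSpace n →ₗ[ℂ] PhaseSpace n} {A : BargmannSpace Φ₁ →L[ℂ] BargmannSpace Φ₂}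
    (hA : IsFourierIntegralOperator κ A) {c : ℂ} {k : (Fin n → ℂ) → BargmannSpace Φ₁}
    (hk : ∀ y z, k y z = c * Complex.exp (quadExponent P₁ L₁ P₁ᴴ z (star y))) :
    ∃ (C : ℂ) (R K T : Matrix (Fin n) (Fin n) ℂ), Rᵀ = R ∧ Tᵀ = T ∧
      IsKernelRelation P₁ L₁ R K T κ ∧
      ∀ x y, A (k y) x = C * Complex.exp (quadExponent R K T x (star y)) := by
  obtain ⟨-, N, φ, a, p, M, -, hgen, hgood, hint⟩ := hA
  obtain ⟨X, B, D, hφ⟩ := exists_isPhaseHessian φ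
  set E := yIncl n N
  -- The Hessian in (y, θ) of the full exponent iφ + y · P₁ y + 2 y · L₁ ω.
  set S := Complex.I • D + (2 : ℂ) • (E * P₁ * Eᵀ)
  have hS : Sᵀ = S := by
    simp [S, transpose_mul, hφ.symm_right, h₁.symm, Matrix.mul_assoc]
  have hSz : ∀ z, z ⬝ᵥ S *ᵥ z = Complex.I * (z ⬝ᵥ D *ᵥ z) + 2 * (yPart z ⬝ᵥ P₁ *ᵥ yPart z) := by
    intro z
    have h2 : z ⬝ᵥ (E * P₁ * Eᵀ) *ᵥ z = yPart z ⬝ᵥ P₁ *ᵥ yPart z := by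
      have := mulVec_dotProduct_mulVec_mulVec Eᵀ P₁ Eᵀ z z
      rw [transpose_transpose, yIncl_transpose_mulVec] at this
      exact this.symm
    simp only [S, add_mulVec, smul_mulVec, dotProduct_add, dotProduct_smul, h2, smul_eq_mul]
  have hneg : ∀ x (t : Fin n ⊕ Fin N → ℝ), t ≠ 0 →
      ((M x *ᵥ fun i => (t i : ℂ)) ⬝ᵥ S *ᵥ M x *ᵥ fun i => (t i : ℂ)).re < 0 := by
    intro x t ht
    have h := (hgood x).phase_neg ht
    generalize M x *ᵥ (fun i => (t i : ℂ)) = v at h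
    have h0 := hφ.apply 0 v
    -- Half the real part of v · S v is the quadratic part of the phase weight minus the Levi form,
    -- so it is negative along the contour.
    have h3 := h₁.levi_nonneg (yPart v)
    simp only [phasePoint] at h0
    rw [phaseWeight, h0, h₁.apply] at h
    rw [hSz]
    simp at h ⊢
    linarith
  choose hS0 G hG hgauss using fun x => exists_contourIntegral_gaussian hS (hneg x)
  have hdet : S.det ≠ 0 := hS0 0
  set J := S⁻¹
  have hJ : Jᵀ = J := by simp [J, transpose_nonsing_inv, hS]
  have hSJ : S * J = 1 := mul_nonsing_inv _ hdet.isUnit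
  have hJS : J * S = 1 := nonsing_inv_mul _ hdet.isUnit
  set F := E * L₁
  -- The three blocks of the critical value -b · J b / 2, with b = i Bᵀx + 2Fω, plus the terms of
  -- the exponent free of (y, θ).
  set R : Matrix (Fin n) (Fin n) ℂ := (Complex.I / 2) • X + (1 / 2 : ℂ) • (B * J * Bᵀ)
  set K : Matrix (Fin n) (Fin n) ℂ := (-Complex.I) • (B * J * F)
  set T : Matrix (Fin n) (Fin n) ℂ := P₁ᴴ - (2 : ℂ) • (Fᵀ * J * F)
  have hPH : P₁ᴴᵀ = P₁ᴴ := by rw [conjTranspose, ← transpose_map, h₁.symm, h₁.symm]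
  have hker : ∀ x y, A (k y) x
      = a * c * G x * Complex.exp (quadExponent R K T x (star y)) := by
    intro x y
    set ω := star y
    set b : Fin n ⊕ Fin N → ℂ := Complex.I • (Bᵀ *ᵥ x) + (2 : ℂ) • (F *ᵥ ω)
    have hw : S *ᵥ (-(J *ᵥ b)) + b = 0 := by
      rw [mulVec_neg, mulVec_mulVec, hSJ, one_mulVec, neg_add_cancel]
    have hb : ∀ z, b ⬝ᵥ z = Complex.I * (x ⬝ᵥ B *ᵥ z) + 2 * (yPart z ⬝ᵥ L₁ *ᵥ ω) := by
      intro z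
      rw [add_dotProduct, smul_dotProduct, smul_dotProduct, smul_eq_mul, smul_eq_mul,
        dotProduct_comm (Bᵀ *ᵥ x), ← dotProduct_mulVec_symm B, dotProduct_comm (F *ᵥ ω)]
      simp only [F, ← mulVec_mulVec]
      rw [dotProduct_mulVec_symm E, yIncl_transpose_mulVec, dotProduct_comm _ (yPart z)]
    have hfun : (fun z => Complex.exp (Complex.I * φ (x, yPart z, thetaPart z)) * a * k y (yPart z))
        = fun z => (a * c * Complex.exp (Complex.I / 2 * (x ⬝ᵥ X *ᵥ x) + ω ⬝ᵥ P₁ᴴ *ᵥ ω)) *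
          Complex.exp (1 / 2 * (z ⬝ᵥ S *ᵥ z) + b ⬝ᵥ z) := by
      funext z
      have h0 := hφ.apply x z
      simp only [phasePoint] at h0
      rw [hk, h0, show ∀ u v w s : ℂ, u * v * (w * s) = v * w * (u * s) by intros; ring,
        mul_assoc (a * c), ← Complex.exp_add, ← Complex.exp_add, hSz, hb, quadExponent]
      congr 2
      ring
    have hval : 1 / 2 * (b ⬝ᵥ -(J *ᵥ b)) = 1 / 2 * (x ⬝ᵥ (B * J * Bᵀ) *ᵥ x)
        - 2 * Complex.I * (x ⬝ᵥ (B * J * F) *ᵥ ω) - 2 * (ω ⬝ᵥ (Fᵀ * J * F) *ᵥ ω) := by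
      have e1 := mulVec_dotProduct_mulVec_mulVec Bᵀ J Bᵀ x x
      have e2 := mulVec_dotProduct_mulVec_mulVec Bᵀ J F x ω
      have e3 := mulVec_dotProduct_mulVec_mulVec F J F ω ω
      have e4 : (F *ᵥ ω) ⬝ᵥ J *ᵥ Bᵀ *ᵥ x = (Bᵀ *ᵥ x) ⬝ᵥ J *ᵥ F *ᵥ ω := by
        rw [dotProduct_mulVec_symm, hJ]
      rw [transpose_transpose] at e1 e2
      simp only [b, mulVec_add, mulVec_smul, dotProduct_neg, dotProduct_add, add_dotProduct,
        dotProduct_smul, smul_dotProduct, smul_eq_mul, e4, e1, e2, e3]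
      linear_combination (-1 / 2 * (x ⬝ᵥ (B * J * Bᵀ) *ᵥ x)) * Complex.I_sq
    rw [hint, hfun]
    have hc : ∀ (u : ℂ) g, contourIntegral (p x) (M x) (fun z => u * g z)
        = u * contourIntegral (p x) (M x) g := by
      intro u g
      simp only [contourIntegral]
      rw [integral_const_mul]
      ring
    rw [hc, hgauss x b (p x) _ hw, hval]
    rw [mul_assoc (a * c), mul_left_comm _ (G x), ← Complex.exp_add, ← mul_assoc]
    congr 2
    simp only [quadExponent, R, K, T, add_mulVec, sub_mulVec, smul_mulVec, dotProduct_add,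
      dotProduct_sub, dotProduct_smul, smul_eq_mul]
    ring
  -- The contour depends on x, so the Gaussian constant is known only up to sign. The square is
  -- constant and A k_0 is continuous, so the sign cannot jump on the connected space ℂⁿ.
  have hconst : ∀ x, a * c * G x = a * c * G 0 := by
    have hS0' : (-S).det ≠ 0 := by
      rw [det_neg]
      exact mul_ne_zero (pow_ne_zero _ (by norm_num)) hdet
    have hsq : ∀ x, (a * c * G x) ^ 2 = (a * c * G 0) ^ 2 := fun x => by
      rw [mul_pow, mul_pow (a * c), mul_right_cancel₀ hS0' ((hG x).trans (hG 0).symm)]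
    by_cases h0 : a * c * G 0 = 0
    · intro x
      have := hsq x
      rw [h0] at this
      rw [h0]
      simpa using this
    have hcont : Continuous fun x => a * c * G x := by
      have : (fun x => a * c * G x)
          = fun x => A (k 0) x * Complex.exp (-quadExponent R K T x (star 0)) := by
        funext x
        rw [hker, mul_assoc _ (Complex.exp _), ← Complex.exp_add, add_neg_cancel, Complex.exp_zero,
          mul_one]
      rw [this]
      refine (A (k 0)).differentiable.continuous.mul ?_
      simp only [quadExponent]
      fun_prop
    intro x
    exact isPreconnected_univ.eq_of_sq_eq hcont.continuousOn continuousOn_const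
      (fun x _ => hsq x) (fun _ => h0) (Set.mem_univ 0) rfl (Set.mem_univ x)
  refine ⟨a * c * G 0, R, K, T, ?_, ?_, ?_, fun x y => by rw [hker, hconst]⟩
  · simp [R, transpose_mul, hJ, hφ.symm_left, Matrix.mul_assoc]
  · simp [T, transpose_mul, hJ, hPH, Matrix.mul_assoc]
  · intro z ω
    obtain ⟨x, y, θ, hθ, hρ, hμ⟩ := (hgen (polarPoint P₁ L₁ z ω) _).1 rfl
    set w : Fin n ⊕ Fin N → ℂ := Sum.elim y θ
    have hpt : (x, y, θ) = phasePoint x w := rfl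
    rw [hpt, hφ.gradTheta] at hθ
    rw [hpt, hφ.gradY] at hρ
    rw [hpt, hφ.gradX] at hμ
    obtain rfl : z = yPart w := congrArg Prod.fst hρ
    have hy : (2 / Complex.I) • (P₁ *ᵥ yPart w + L₁ *ᵥ ω) = -yPart (Bᵀ *ᵥ x + D *ᵥ w) :=
      congrArg Prod.snd hρ
    -- The conditions φ'_θ = 0 and -φ'_y = (2/i)(P₁ y + L₁ ω) of the graph are together the critical
    -- point equation of the Gaussian exponent.
    have hcrit : S *ᵥ w + (Complex.I • (Bᵀ *ᵥ x) + (2 : ℂ) • (F *ᵥ ω)) = 0 := by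
      have e : S *ᵥ w + (Complex.I • (Bᵀ *ᵥ x) + (2 : ℂ) • (F *ᵥ ω))
          = Complex.I • (Bᵀ *ᵥ x + D *ᵥ w) + (2 : ℂ) • (E *ᵥ (P₁ *ᵥ yPart w + L₁ *ᵥ ω)) := by
        simp only [S, F, add_mulVec, smul_mulVec, ← mulVec_mulVec, E, yIncl_transpose_mulVec,
          mulVec_add]
        module
      rw [e]
      generalize Bᵀ *ᵥ x + D *ᵥ w = g at hθ hy
      generalize P₁ *ᵥ yPart w + L₁ *ᵥ ω = v at hy
      funext i
      rcases i with j | j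
      · have e1 := congrFun hy j
        have e2 : (E *ᵥ v) (Sum.inl j) = v j := congrFun (yPart_yIncl_mulVec (N := N) v) j
        simp only [Pi.add_apply, Pi.smul_apply, e2, smul_eq_mul, Pi.zero_apply, Pi.neg_apply,
          yPart] at e1 ⊢
        field_simp at e1
        linear_combination e1
      · have e1 := congrFun hθ j
        have e2 : (E *ᵥ v) (Sum.inr j) = 0 := congrFun (thetaPart_yIncl_mulVec (N := N) v) j
        simp only [Pi.add_apply, Pi.smul_apply, e2, smul_eq_mul, Pi.zero_apply, thetaPart] at e1 ⊢
        rw [e1]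
        simp
    have hw : w = -(J *ᵥ (Complex.I • (Bᵀ *ᵥ x) + (2 : ℂ) • (F *ᵥ ω))) := by
      rw [← neg_eq_of_add_eq_zero_right hcrit, mulVec_neg, mulVec_mulVec, hJS, one_mulVec, neg_neg]
    refine ⟨x, ?_, ?_⟩
    · have hz : L₁ᵀ *ᵥ yPart w = Fᵀ *ᵥ w := by
        rw [← yIncl_transpose_mulVec, mulVec_mulVec, ← transpose_mul]
      rw [hz, hw]
      simp only [K, T, transpose_smul, transpose_mul, hJ, sub_mulVec, smul_mulVec, mulVec_neg,
        mulVec_add, mulVec_smul, mulVec_mulVec, Matrix.mul_assoc]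
      module
    · rw [hμ, polarPoint, Prod.mk.injEq]
      refine ⟨rfl, ?_⟩
      rw [hw]
      simp only [R, K, add_mulVec, smul_mulVec, mulVec_neg, mulVec_add, mulVec_smul, mulVec_mulVec,
        Matrix.mul_assoc, smul_add, smul_smul]
      have hI : (2 / Complex.I) * (Complex.I / 2) = 1 := by field_simp
      have hI' : (2 / Complex.I) * (1 / 2) = -Complex.I := by
        rw [Complex.div_I]; ring
      have hI'' : (2 / Complex.I) * -Complex.I = -2 := by field_simp
      rw [hI, hI', hI'']
      module

end Kernel

/-! ## Kernel exponents and canonical transformations -/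

section Relation

open Matrix

variable {n : ℕ} {P L R K T : Matrix (Fin n) (Fin n) ℂ}

theorem Matrix.star_mulVec_eq {m m' : Type*} [Fintype m'] (A : Matrix m m' ℂ) (v : m' → ℂ) :
    star (A *ᵥ v) = Aᴴᵀ *ᵥ star v := by
  rw [star_mulVec, mulVec_transpose]

theorem Matrix.conjTranspose_transpose_of_symm {m : Type*} {A : Matrix m m ℂ} (hA : Aᵀ = A) :
    Aᴴᵀ = Aᴴ := by
  rw [conjTranspose, ← transpose_map, hA, hA]

theorem conj_dotProduct_mulVec {m m' : Type*} [Fintype m] [Fintype m'] (A : Matrix m m' ℂ)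
    (x : m → ℂ) (y : m' → ℂ) : conj (x ⬝ᵥ A *ᵥ y) = star y ⬝ᵥ Aᴴ *ᵥ star x := by
  rw [starRingEnd_apply, ← star_dotProduct_star, star_mulVec_eq, dotProduct_comm,
    dotProduct_mulVec_symm, transpose_transpose]

theorem conj_quadExponent (x y : Fin n → ℂ) :
    conj (quadExponent R K T x (star y)) = quadExponent Tᴴ Kᴴ Rᴴ y (star x) := by
  simp only [quadExponent, map_add, map_mul, conj_dotProduct_mulVec, star_star, map_ofNat]
  ring

theorem quadExponent_smul (r : ℂ) (x ω : Fin n → ℂ) :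
    quadExponent R K T (r • x) (r • ω) = r ^ 2 * quadExponent R K T x ω := by
  simp only [quadExponent, mulVec_smul, dotProduct_smul, smul_dotProduct, smul_eq_mul]
  ring

theorem eq_of_forall_dotProduct_mulVec_self_eq {Q Q' : Matrix (Fin n) (Fin n) ℂ} (hQ : Qᵀ = Q)
    (hQ' : Q'ᵀ = Q') (h : ∀ x, x ⬝ᵥ Q *ᵥ x = x ⬝ᵥ Q' *ᵥ x) : Q = Q' := by
  ext i j
  have h1 := h (Pi.single i 1 + Pi.single j 1)
  have h2 := h (Pi.single i 1)
  have h3 := h (Pi.single j 1)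
  have h4 : ∀ A : Matrix (Fin n) (Fin n) ℂ, Aᵀ = A → A j i = A i j := fun A hA =>
    congrFun (congrFun hA i) j
  simp only [mulVec_add, dotProduct_add, add_dotProduct, mulVec_single_one,
    single_one_dotProduct, col_apply] at h1 h2 h3
  rw [h4 Q hQ, h4 Q' hQ'] at h1
  linear_combination (1 / 2 : ℂ) * h1 - (1 / 2 : ℂ) * h2 - (1 / 2 : ℂ) * h3

/-- A non-zero Gaussian kernel determines its exponent. -/
theorem eq_of_exp_quadExponent_eq {R' K' T' : Matrix (Fin n) (Fin n) ℂ} (hR : Rᵀ = R) (hT : Tᵀ = T)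
    (hR' : R'ᵀ = R') (hT' : T'ᵀ = T') {C C' : ℂ} (hC : C ≠ 0)
    (h : ∀ x y, C * Complex.exp (quadExponent R K T x (star y))
      = C' * Complex.exp (quadExponent R' K' T' x (star y))) : R = R' ∧ K = K' ∧ T = T' := by
  have h0 : C = C' := by simpa [quadExponent] using h 0 0
  subst h0
  have hq : ∀ x ω, quadExponent R K T x ω = quadExponent R' K' T' x ω := by
    intro x ω
    by_contra hne
    have hd : quadExponent R K T x ω - quadExponent R' K' T' x ω ≠ 0 := sub_ne_zero.2 hne
    -- Rescaling by r makes the difference of the two exponents equal to 1, while exp 1 ≠ 1.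
    obtain ⟨r, hr⟩ := IsAlgClosed.exists_pow_nat_eq
      (quadExponent R K T x ω - quadExponent R' K' T' x ω)⁻¹ (n := 2) two_pos
    have h1 := mul_left_cancel₀ hC (h (r • x) (star (r • ω)))
    rw [star_star, quadExponent_smul, quadExponent_smul] at h1
    have h2 := congrArg (· * Complex.exp (-(r ^ 2 * quadExponent R' K' T' x ω))) h1
    simp only [← Complex.exp_add, add_neg_cancel, Complex.exp_zero] at h2
    rw [← sub_eq_add_neg, ← mul_sub, hr, inv_mul_cancel₀ hd] at h2
    have h3 := congrArg norm h2
    rw [Complex.norm_exp, norm_one, Complex.one_re, Real.exp_eq_one_iff] at h3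
    exact one_ne_zero h3
  have eR : R = R' := eq_of_forall_dotProduct_mulVec_self_eq hR hR' fun x => by
    simpa [quadExponent] using hq x 0
  have eT : T = T' := eq_of_forall_dotProduct_mulVec_self_eq hT hT' fun x => by
    simpa [quadExponent] using hq 0 x
  subst eR eT
  refine ⟨rfl, ?_, rfl⟩
  ext i j
  have h1 := hq (Pi.single i 1) (Pi.single j 1)
  simpa [quadExponent] using h1

namespace IsKernelRelation

variable {κ : PhaseSpace n →ₗ[ℂ] PhaseSpace n} {Φ : QuadraticForm ℝ (Fin n → ℂ)}

/-- At ω = 0 the relation solves Kᵀx = Lᵀz for every z, so the square matrix Kᵀ is onto. -/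
theorem injective (hrel : IsKernelRelation P L R K T κ) (h : IsHessianPair Φ P L) :
    Function.Injective (Kᵀ *ᵥ ·) := by
  have hs : Function.Surjective (Kᵀ *ᵥ ·) := by
    intro v
    have hL : IsUnit Lᵀ.det := by
      rw [det_transpose]
      exact h.det_levi_ne_zero.isUnit
    obtain ⟨x, hx, -⟩ := hrel (Lᵀ⁻¹ *ᵥ v) 0
    refine ⟨x, ?_⟩
    rw [mulVec_mulVec, mul_nonsing_inv _ hL] at hx
    simpa using hx
  exact mulVec_injective_iff_isUnit.2 (mulVec_surjective_iff_isUnit.1 hs)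

theorem apply_eq (hrel : IsKernelRelation P L R K T κ) (h : IsHessianPair Φ P L)
    {x z ω : Fin n → ℂ} (hx : Kᵀ *ᵥ x + T *ᵥ ω = Lᵀ *ᵥ z + Pᴴ *ᵥ ω) :
    κ (polarPoint P L z ω) = polarPoint R K x ω := by
  obtain ⟨x', hx', hκ⟩ := hrel z ω
  have : x' = x := hrel.injective h (add_right_cancel (hx'.trans hx.symm))
  rw [hκ, this]

theorem unique {κ' : PhaseSpace n →ₗ[ℂ] PhaseSpace n} (hrel : IsKernelRelation P L R K T κ)
    (hrel' : IsKernelRelation P L R K T κ') (h : IsHessianPair Φ P L) : κ' = κ := by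
  refine LinearMap.ext fun ρ => ?_
  obtain ⟨z, ω, rfl⟩ := h.exists_polarPoint ρ
  obtain ⟨x, hx, hκ⟩ := hrel' z ω
  rw [hκ, hrel.apply_eq h hx]

/-- The adjoint exponent generates `ι₁ ∘ κ⁻¹ ∘ ι₂`. -/
theorem adjoint {Φ₁ Φ₂ : QuadraticForm ℝ (Fin n → ℂ)} {P₁ L₁ P₂ L₂ : Matrix (Fin n) (Fin n) ℂ}
    (h₁ : IsHessianPair Φ₁ P₁ L₁) (h₂ : IsHessianPair Φ₂ P₂ L₂)
    (hΦ₁ : StrictlyPlurisubharmonic Φ₁) (hΦ₂ : StrictlyPlurisubharmonic Φ₂)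
    {κ : PhaseSpace n ≃ₗ[ℂ] PhaseSpace n} (hR : Rᵀ = R) (hT : Tᵀ = T)
    (hrel : IsKernelRelation P₁ L₁ R K T (κ : PhaseSpace n →ₗ[ℂ] PhaseSpace n)) :
    IsKernelRelation P₂ L₂ Tᴴ Kᴴ Rᴴ ((reflection hΦ₁).comp
      ((κ.symm : PhaseSpace n →ₗ[ℂ] PhaseSpace n).comp (reflection hΦ₂))) := by
  intro x θ
  obtain ⟨z, ω, hzω⟩ := h₁.exists_polarPoint (κ.symm (polarPoint P₂ L₂ (star θ) (star x)))
  obtain ⟨x', hx', hκ⟩ := hrel z ω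
  rw [← hzω] at hκ
  simp only [LinearEquiv.coe_coe, LinearEquiv.apply_symm_apply, polarPoint, Prod.mk.injEq] at hκ
  obtain ⟨rfl, hκ⟩ := hκ
  have hκ' : P₂ *ᵥ star θ + L₂ *ᵥ star x = R *ᵥ star θ + K *ᵥ ω :=
    smul_right_injective _ (show (2 / Complex.I : ℂ) ≠ 0 by simp) hκ
  -- The reflections swap and conjugate both pairs of coordinates, so the two equations of the
  -- relation for κ⁻¹, once conjugated, exchange their roles.
  refine ⟨star ω, ?_, ?_⟩
  · have := congrArg star hκ'
    simp only [star_add, star_mulVec_eq, star_star, conjTranspose_transpose_of_symm hR,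
      conjTranspose_transpose_of_symm h₂.symm, h₂.herm] at this
    rw [add_comm, ← this, add_comm]
  · simp only [LinearMap.comp_apply, LinearEquiv.coe_coe]
    rw [h₂.reflection_polarPoint, hzω, h₁.reflection_polarPoint]
    have := congrArg star hx'
    simp only [star_add, star_mulVec_eq, star_star, conjTranspose_transpose_of_symm hT] at this
    simp only [conjTranspose_conjTranspose, h₁.symm] at this
    have e1 : Kᵀᴴᵀ = Kᴴ := rfl
    have e2 : L₁ᵀᴴᵀ = L₁ := h₁.herm
    rw [e1, e2] at this
    rw [polarPoint, polarPoint, add_comm (P₁ *ᵥ _), ← this, add_comm]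

/-- Write ℓ for a Levi form and (x, τ) for the image of (z, 0). Positivity reads ℓ₁(z) + ℓ₂(τ̄) ≤
ℓ₂(x), and ℓ₂(x - τ̄) ≥ 0 bounds 2 Re(x · L₂ τ) by ℓ₂(x) + ℓ₂(τ̄). As L₂ τ = R x - P₂ x, the two
give Re(x · R x) ≤ Φ₂(x) - ℓ₁(z)/2. Strictness comes from z ≠ 0, that is, from injectivity of Kᵀ. -/
theorem re_lt_of_isPositiveRel {Φ₁ Φ₂ : QuadraticForm ℝ (Fin n → ℂ)}
    {P₁ L₁ P₂ L₂ : Matrix (Fin n) (Fin n) ℂ} (h₁ : IsHessianPair Φ₁ P₁ L₁)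
    (h₂ : IsHessianPair Φ₂ P₂ L₂) {hΦ₁ : StrictlyPlurisubharmonic Φ₁}
    {hΦ₂ : StrictlyPlurisubharmonic Φ₂} (hpos : IsPositiveRel hΦ₂ hΦ₁ κ)
    (hrel : IsKernelRelation P₁ L₁ R K T κ) {x : Fin n → ℂ} (hx : x ≠ 0) :
    (x ⬝ᵥ R *ᵥ x).re < Φ₂ x := by
  have hL : IsUnit L₁ᵀ.det := by
    rw [det_transpose]
    exact h₁.det_levi_ne_zero.isUnit
  set z := L₁ᵀ⁻¹ *ᵥ Kᵀ *ᵥ x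
  have hz : L₁ᵀ *ᵥ z = Kᵀ *ᵥ x := by
    rw [mulVec_mulVec, mul_nonsing_inv _ hL, one_mulVec]
  have hz0 : z ≠ 0 := by
    intro h0
    rw [h0, mulVec_zero] at hz
    exact hx (hrel.injective h₁ (by simp only [← hz, mulVec_zero]))
  set τ := L₂⁻¹ *ᵥ (R *ᵥ x - P₂ *ᵥ x)
  have hτ : L₂ *ᵥ τ = R *ᵥ x - P₂ *ᵥ x := by
    rw [mulVec_mulVec, mul_nonsing_inv _ h₂.det_levi_ne_zero.isUnit, one_mulVec]
  have hκ : κ (polarPoint P₁ L₁ z 0) = polarPoint P₂ L₂ x τ := by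
    rw [hrel.apply_eq h₁ (x := x) (by simp [hz]), polarPoint, polarPoint, hτ]
    simp
  have e1 := h₁.levi_le_of_isPositiveRel h₂ hpos hκ
  have e2 := h₂.levi_nonneg (x - star τ)
  have e3 := h₁.pos z hz0
  rw [h₂.levi_sub, star_star, hτ] at e2
  simp only [dotProduct_sub, Complex.sub_re, star_zero, mulVec_zero,
    Complex.zero_re, dotProduct_zero] at e1 e2
  rw [h₂.apply]
  rw [hτ] at e1
  simp only [dotProduct_sub, Complex.sub_re] at e1
  linarith

end IsKernelRelation

end Relation

/-! ## Fourier integral operators with a given kernel exponent -/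

section Construction

open Matrix

variable {n : ℕ} {P L R K T : Matrix (Fin n) (Fin n) ℂ}

/-- The phase function `-i (quadExponent R K T x θ - 2 Φ(y, θ))`. -/
noncomputable def kernelPhase (P L R K T : Matrix (Fin n) (Fin n) ℂ) :
    QuadraticForm ℂ (PhaseDomain n n) :=
  let X : PhaseDomain n n →ₗ[ℂ] (Fin n → ℂ) := LinearMap.fst ℂ _ _
  let Y : PhaseDomain n n →ₗ[ℂ] (Fin n → ℂ) := LinearMap.fst ℂ _ _ ∘ₗ LinearMap.snd ℂ _ _
  let Θ : PhaseDomain n n →ₗ[ℂ] (Fin n → ℂ) := LinearMap.snd ℂ _ _ ∘ₗ LinearMap.snd ℂ _ _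
  let q (A : Matrix (Fin n) (Fin n) ℂ) (f g : PhaseDomain n n →ₗ[ℂ] (Fin n → ℂ)) :=
    LinearMap.BilinMap.toQuadraticMap ((Matrix.toLinearMap₂' ℂ A).compl₁₂ f g)
  (-Complex.I) • (q R X X + (2 : ℂ) • q K X Θ + q T Θ Θ
    - (q P Y Y + (2 : ℂ) • q L Y Θ + q Pᴴ Θ Θ))

theorem kernelPhase_apply (x y θ : Fin n → ℂ) :
    kernelPhase P L R K T (x, y, θ)
      = -Complex.I * (quadExponent R K T x θ - quadExponent P L Pᴴ y θ) := by
  simp [kernelPhase, quadExponent, Matrix.toLinearMap₂'_apply']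

theorem polar_kernelPhase (hR : Rᵀ = R) (hT : Tᵀ = T) (hP : Pᵀ = P) (x y θ x' y' θ' : Fin n → ℂ) :
    QuadraticMap.polar (kernelPhase P L R K T) (x, y, θ) (x', y', θ')
      = -(2 * Complex.I) * (x' ⬝ᵥ (R *ᵥ x + K *ᵥ θ) - y' ⬝ᵥ (P *ᵥ y + L *ᵥ θ)
        + θ' ⬝ᵥ (Kᵀ *ᵥ x + T *ᵥ θ - (Lᵀ *ᵥ y + Pᴴ *ᵥ θ))) := by
  rw [QuadraticMap.polar, Prod.mk_add_mk, Prod.mk_add_mk, kernelPhase_apply, kernelPhase_apply,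
    kernelPhase_apply]
  have e1 : x ⬝ᵥ R *ᵥ x' = x' ⬝ᵥ R *ᵥ x := by rw [dotProduct_mulVec_symm, hR]
  have e2 : θ ⬝ᵥ T *ᵥ θ' = θ' ⬝ᵥ T *ᵥ θ := by rw [dotProduct_mulVec_symm, hT]
  have e3 : y ⬝ᵥ P *ᵥ y' = y' ⬝ᵥ P *ᵥ y := by rw [dotProduct_mulVec_symm, hP]
  have e4 : θ ⬝ᵥ Pᴴ *ᵥ θ' = θ' ⬝ᵥ Pᴴ *ᵥ θ := by
    rw [dotProduct_mulVec_symm, conjTranspose_transpose_of_symm hP]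
  have e5 : θ' ⬝ᵥ Kᵀ *ᵥ x = x ⬝ᵥ K *ᵥ θ' := (dotProduct_mulVec_symm _ _ _).symm
  have e6 : θ' ⬝ᵥ Lᵀ *ᵥ y = y ⬝ᵥ L *ᵥ θ' := (dotProduct_mulVec_symm _ _ _).symm
  simp only [quadExponent, mulVec_add, dotProduct_add, add_dotProduct, dotProduct_sub, e1, e2, e3,
    e4, e5, e6]
  ring

theorem phaseGradX_kernelPhase (hR : Rᵀ = R) (hT : Tᵀ = T) (hP : Pᵀ = P) (x y θ : Fin n → ℂ) :
    phaseGradX (kernelPhase P L R K T) (x, y, θ) = (2 / Complex.I) • (R *ᵥ x + K *ᵥ θ) := by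
  funext j
  rw [phaseGradX, polar_kernelPhase hR hT hP, Complex.div_I]
  simp

theorem phaseGradY_kernelPhase (hR : Rᵀ = R) (hT : Tᵀ = T) (hP : Pᵀ = P) (x y θ : Fin n → ℂ) :
    phaseGradY (kernelPhase P L R K T) (x, y, θ) = -((2 / Complex.I) • (P *ᵥ y + L *ᵥ θ)) := by
  funext j
  rw [phaseGradY, polar_kernelPhase hR hT hP, Complex.div_I]
  simp
  ring

theorem phaseGradTheta_kernelPhase (hR : Rᵀ = R) (hT : Tᵀ = T) (hP : Pᵀ = P) (x y θ : Fin n → ℂ) :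
    phaseGradTheta (kernelPhase P L R K T) (x, y, θ)
      = (2 / Complex.I) • (Kᵀ *ᵥ x + T *ᵥ θ - (Lᵀ *ᵥ y + Pᴴ *ᵥ θ)) := by
  funext j
  rw [phaseGradTheta, polar_kernelPhase hR hT hP, Complex.div_I]
  simp

theorem phaseGradTheta_kernelPhase_eq_zero_iff (hR : Rᵀ = R) (hT : Tᵀ = T) (hP : Pᵀ = P)
    {x y θ : Fin n → ℂ} : phaseGradTheta (kernelPhase P L R K T) (x, y, θ) = 0
      ↔ Kᵀ *ᵥ x + T *ᵥ θ = Lᵀ *ᵥ y + Pᴴ *ᵥ θ := by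
  rw [phaseGradTheta_kernelPhase hR hT hP, smul_eq_zero, sub_eq_zero]
  simp

variable {Φ : QuadraticForm ℝ (Fin n → ℂ)}

/-- The block φ''_θy is a non-zero multiple of the invertible matrix Lᵀ, so varying y alone
suffices. -/
theorem isNondegeneratePhase_kernelPhase (hR : Rᵀ = R) (hT : Tᵀ = T) (h : IsHessianPair Φ P L) :
    IsNondegeneratePhase (kernelPhase P L R K T) := by
  intro v
  have hL : IsUnit Lᵀ.det := by
    rw [det_transpose]
    exact h.det_levi_ne_zero.isUnit
  refine ⟨(0, Lᵀ⁻¹ *ᵥ (-(Complex.I / 2)) • v, 0), ?_⟩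
  rw [phaseGradTheta_kernelPhase hR hT h.symm, mulVec_mulVec, mul_nonsing_inv _ hL, one_mulVec]
  simp only [mulVec_zero, add_zero, zero_sub, ← neg_smul, neg_neg, smul_smul]
  rw [div_mul_div_comm, mul_comm, div_self (by simp), one_smul]

theorem IsKernelRelation.generates {κ : PhaseSpace n →ₗ[ℂ] PhaseSpace n}
    (hrel : IsKernelRelation P L R K T κ) (hR : Rᵀ = R) (hT : Tᵀ = T) (h : IsHessianPair Φ P L) :
    Generates (kernelPhase P L R K T) κ := by
  intro ρ μ
  constructor
  · rintro rfl
    obtain ⟨y, θ, rfl⟩ := h.exists_polarPoint ρ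
    obtain ⟨x, hx, hκ⟩ := hrel y θ
    refine ⟨x, y, θ, (phaseGradTheta_kernelPhase_eq_zero_iff hR hT h.symm).2 hx, ?_, ?_⟩
    · rw [phaseGradY_kernelPhase hR hT h.symm, neg_neg, polarPoint]
    · rw [hκ, phaseGradX_kernelPhase hR hT h.symm, polarPoint]
  · rintro ⟨x, y, θ, hθ, rfl, rfl⟩
    rw [phaseGradY_kernelPhase hR hT h.symm, neg_neg, phaseGradX_kernelPhase hR hT h.symm]
    exact hrel.apply_eq h ((phaseGradTheta_kernelPhase_eq_zero_iff hR hT h.symm).1 hθ)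

/-! ### The contour `θ = ȳ` -/

/-- The point `(y, ȳ)`. -/
def conjPoint (y : Fin n → ℂ) : Fin n ⊕ Fin n → ℂ := Sum.elim y (star y)

/-- The complex coordinates of a real vector. -/
def complexCoord (t : Fin n ⊕ Fin n → ℝ) : Fin n → ℂ := fun j => ⟨t (Sum.inl j), t (Sum.inr j)⟩

/-- The matrix of the parametrization `(s, t) ↦ (s + i t, s - i t)` of the contour `θ = ȳ`. -/
def conjContour (n : ℕ) : Matrix (Fin n ⊕ Fin n) (Fin n ⊕ Fin n) ℂ :=
  fromBlocks 1 (Complex.I • 1) 1 (-Complex.I • 1)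

theorem conjContour_mulVec (t : Fin n ⊕ Fin n → ℝ) :
    conjContour n *ᵥ (fun i => (t i : ℂ)) = conjPoint (complexCoord t) := by
  rw [conjContour, fromBlocks_mulVec]
  funext i
  rcases i with j | j
  · simp only [Sum.elim_inl, conjPoint, complexCoord, one_mulVec, smul_mulVec, Pi.add_apply,
      Pi.smul_apply, Function.comp_apply, smul_eq_mul]
    apply Complex.ext <;> simp
  · simp only [Sum.elim_inr, conjPoint, complexCoord, one_mulVec, smul_mulVec, Pi.add_apply,
      Pi.smul_apply, Function.comp_apply, smul_eq_mul, Pi.star_apply]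
    apply Complex.ext <;> simp

theorem det_conjContour_ne_zero : (conjContour n).det ≠ 0 := by
  rw [conjContour, det_fromBlocks_one₁₁, Matrix.one_mul, ← sub_smul, det_smul, det_one, mul_one]
  refine pow_ne_zero _ ?_
  rw [sub_eq_add_neg, ← two_mul]
  simp

theorem conjPoint_add (y v : Fin n → ℂ) : conjPoint (y + v) = conjPoint y + conjPoint v := by
  funext i
  rcases i with j | j <;> simp [conjPoint]

theorem contourPoint_conjContour (y : Fin n → ℂ) (t : Fin n ⊕ Fin n → ℝ) :
    contourPoint (conjPoint y) (conjContour n) t = conjPoint (y + complexCoord t) := by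
  rw [contourPoint, conjContour_mulVec, conjPoint_add]

theorem yPart_conjPoint (y : Fin n → ℂ) : yPart (conjPoint y) = y := rfl

theorem thetaPart_conjPoint (y : Fin n → ℂ) : thetaPart (conjPoint y) = star y := rfl

theorem norm_conjPoint (y : Fin n → ℂ) : ‖conjPoint y‖ ≤ ‖y‖ := by
  refine (pi_norm_le_iff_of_nonneg (norm_nonneg _)).2 fun i => ?_
  rcases i with j | j
  · exact norm_le_pi_norm y j
  · simpa [conjPoint] using norm_le_pi_norm y j

theorem measurePreserving_complexCoord :
    MeasurePreserving (complexCoord : (Fin n ⊕ Fin n → ℝ) → Fin n → ℂ) := by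
  have h1 := volume_measurePreserving_sumPiEquivProdPi (fun _ : Fin n ⊕ Fin n => ℝ)
  have h2 := (volume_measurePreserving_arrowProdEquivProdArrow ℝ ℝ (Fin n)).symm
  have h3 : MeasurePreserving (fun (f : Fin n → ℝ × ℝ) i => Complex.measurableEquivRealProd.symm (f i)) :=
    volume_preserving_pi fun _ : Fin n => Complex.volume_preserving_equiv_real_prod.symm
  exact h3.comp (h2.comp h1)

/-- The contour θ = ȳ is invariant under translation by (y, ȳ), so the base point drops out. -/
theorem contourIntegral_conjContour (y : Fin n → ℂ) (g : (Fin n ⊕ Fin n → ℂ) → ℂ) :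
    contourIntegral (conjPoint y) (conjContour n) g
      = (conjContour n).det * ∫ x, g (conjPoint x) := by
  have hemb : MeasurableEmbedding (complexCoord : (Fin n ⊕ Fin n → ℝ) → Fin n → ℂ) := by
    have hc : Continuous (complexCoord : (Fin n ⊕ Fin n → ℝ) → Fin n → ℂ) := by
      refine continuous_pi fun j => ?_
      exact Complex.equivRealProdCLM.symm.continuous.comp
        (f := fun t : Fin n ⊕ Fin n → ℝ => (t (Sum.inl j), t (Sum.inr j))) (by fun_prop)
    refine hc.measurableEmbedding fun s t hst => ?_
    funext i
    rcases i with j | j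
    · exact congrArg Complex.re (congrFun hst j)
    · exact congrArg Complex.im (congrFun hst j)
  rw [contourIntegral]
  simp only [contourPoint_conjContour]
  rw [measurePreserving_complexCoord.integral_comp hemb fun x => g (conjPoint (y + x)),
    integral_add_left_eq_self fun x => g (conjPoint x)]

/-! ### The phase weight -/

theorem phaseWeight_kernelPhase (x : Fin n → ℂ) (z : Fin n ⊕ Fin n → ℂ) :
    phaseWeight (kernelPhase P L R K T) Φ x z
      = (quadExponent R K T x (thetaPart z) - quadExponent P L Pᴴ (yPart z) (thetaPart z)).re
        + Φ (yPart z) := by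
  rw [phaseWeight, kernelPhase_apply]
  simp

theorem IsHessianPair.re_quadExponent_star (h : IsHessianPair Φ P L) (y : Fin n → ℂ) :
    quadExponent P L Pᴴ y (star y) = ((2 * Φ y : ℝ) : ℂ) := by
  rw [quadExponent, ← h.conj_hess, h.apply]
  push_cast
  rw [h.ofReal_levi, Complex.re_eq_add_conj]
  ring

/-- At a critical point on `θ = ȳ` the phase weight has no linear part. -/
theorem IsHessianPair.phaseWeight_add (h : IsHessianPair Φ P L) (hT : Tᵀ = T) {x y : Fin n → ℂ}
    (hcrit : Kᵀ *ᵥ x + T *ᵥ star y = Lᵀ *ᵥ y + Pᴴ *ᵥ star y) (w : Fin n ⊕ Fin n → ℂ) :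
    phaseWeight (kernelPhase P L R K T) Φ x (conjPoint y + w)
      = phaseWeight (kernelPhase P L R K T) Φ x (conjPoint y)
        + phaseWeight (kernelPhase P L R K T) Φ 0 w := by
  have hy : yPart (conjPoint y + w) = y + yPart w := rfl
  have hθ : thetaPart (conjPoint y + w) = star y + thetaPart w := rfl
  rw [phaseWeight_kernelPhase, phaseWeight_kernelPhase, phaseWeight_kernelPhase, hy, hθ,
    yPart_conjPoint, thetaPart_conjPoint]
  generalize yPart w = u
  generalize thetaPart w = v
  have e1 : y ⬝ᵥ P *ᵥ u = u ⬝ᵥ P *ᵥ y := by rw [dotProduct_mulVec_symm, h.symm]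
  have e2 : star y ⬝ᵥ T *ᵥ v = v ⬝ᵥ T *ᵥ star y := by rw [dotProduct_mulVec_symm, hT]
  have e3 : star y ⬝ᵥ Pᴴ *ᵥ v = v ⬝ᵥ Pᴴ *ᵥ star y := by
    rw [dotProduct_mulVec_symm, conjTranspose_transpose_of_symm h.symm]
  -- The terms linear in v cancel by the critical equation; those linear in u cancel because 2Φ(·,
  -- ȳ) and Φ have the same real differential at y, up to taking the real part.
  have e4 := congrArg (v ⬝ᵥ ·) hcrit
  simp only [dotProduct_add] at e4
  rw [dotProduct_mulVec_symm Kᵀ, dotProduct_mulVec_symm Lᵀ, transpose_transpose,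
    transpose_transpose] at e4
  have e4' := congrArg Complex.re e4
  have e5 : (y ⬝ᵥ L *ᵥ star u).re = (u ⬝ᵥ L *ᵥ star y).re := by
    rw [← h.conj_levi, Complex.conj_re]
  rw [h.apply, h.apply, h.apply]
  simp only [quadExponent, mulVec_add, dotProduct_add, add_dotProduct, star_add, e1, e2, e3,
    Complex.add_re, Complex.sub_re, Complex.mul_re, Complex.re_ofNat, Complex.im_ofNat,
    zero_dotProduct, Complex.zero_re, Complex.add_im, mulVec_zero, dotProduct_zero,
    Complex.zero_im] at e4' ⊢
  linarith

theorem exists_le_mul_sq_norm {E : Type*} [NormedAddCommGroup E] [NormedSpace ℝ E]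
    [FiniteDimensional ℝ E] {q : E → ℝ} (hq : Continuous q)
    (hom : ∀ (r : ℝ) x, q (r • x) = r ^ 2 * q x) : ∃ C : ℝ, ∀ x, |q x| ≤ C * ‖x‖ ^ 2 := by
  have := FiniteDimensional.proper_real E
  obtain ⟨C, hC⟩ := (isCompact_sphere (0 : E) 1).exists_bound_of_continuousOn hq.continuousOn
  refine ⟨C, fun x => ?_⟩
  by_cases hx : x = 0
  · have := hom 0 0
    simp only [zero_smul, ne_eq, OfNat.ofNat_ne_zero, not_false_eq_true, zero_pow, zero_mul] at this
    simp [hx, this]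
  have hx' : ‖x‖ ≠ 0 := norm_ne_zero_iff.2 hx
  have h2 := hC (‖x‖⁻¹ • x) (by simp [norm_smul, hx'])
  rw [hom, Real.norm_eq_abs, abs_mul, abs_of_nonneg (by positivity), inv_pow, ← div_eq_inv_mul,
    div_le_iff₀ (by positivity)] at h2
  exact h2

theorem hasFDerivAt_zero_of_add_eq {E : Type*} [NormedAddCommGroup E] [NormedSpace ℝ E]
    [FiniteDimensional ℝ E] {f q : E → ℝ} {c : E} (hq : Continuous q)
    (hom : ∀ (r : ℝ) x, q (r • x) = r ^ 2 * q x) (h : ∀ w, f (c + w) = f c + q w) :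
    HasFDerivAt f (0 : E →L[ℝ] ℝ) c := by
  obtain ⟨C, hC⟩ := exists_le_mul_sq_norm hq hom
  have hO : (fun x => f x - f c) =O[𝓝 c] fun x => ‖x - c‖ ^ 2 := by
    refine Asymptotics.IsBigO.of_bound C (Filter.Eventually.of_forall fun x => ?_)
    have := h (x - c)
    rw [add_sub_cancel] at this
    rw [this, add_sub_cancel_left, Real.norm_eq_abs, Real.norm_of_nonneg (by positivity)]
    exact hC _
  have := (hO.hasFDerivAt (𝕜 := ℝ) one_lt_two).add_const (f c)
  simpa using this

/-- On θ = ȳ the quadratic part of the phase weight is Re(ȳ · T ȳ) - 2Φ(y) + Φ(y), negative by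
`hneg`. The same inequality makes the real linear critical equation for y injective, hence solvable,
so every x has a critical point on this contour. -/
theorem IsHessianPair.exists_isGoodContour (h : IsHessianPair Φ P L) (hT : Tᵀ = T)
    (hneg : ∀ y, y ≠ 0 → (star y ⬝ᵥ T *ᵥ star y).re < Φ y) (x : Fin n → ℂ) :
    ∃ y, IsGoodContour (phaseWeight (kernelPhase P L R K T) Φ x) (conjPoint y) (conjContour n) := by
  have hq : Continuous fun y : Fin n → ℂ => Φ y - (star y ⬝ᵥ T *ᵥ star y).re := by
    have := BargmannSpace.continuous_weight Φ
    fun_prop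
  obtain ⟨δ, hδ, hle⟩ := exists_pos_mul_sq_norm_le hq (fun r y => by
    rw [QuadraticMap.map_smul, star_smul, mulVec_smul, dotProduct_smul, smul_dotProduct, smul_smul]
    simp
    ring) (fun y hy => sub_pos.2 (hneg y hy))
  let g : (Fin n → ℂ) →ₗ[ℝ] (Fin n → ℂ) :=
    { toFun := fun y => Lᵀ *ᵥ y + Pᴴ *ᵥ star y - T *ᵥ star y
      map_add' := fun y y' => by
        simp only [star_add, mulVec_add]
        abel
      map_smul' := fun r y => by
        simp only [star_smul, mulVec_smul, star_trivial, smul_add, smul_sub, RingHom.id_apply] }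
  have hg : Function.Injective g := by
    rw [injective_iff_map_eq_zero]
    intro y hy
    by_contra hne
    have h1 : Lᵀ *ᵥ y + Pᴴ *ᵥ star y - T *ᵥ star y = 0 := hy
    -- Pairing with ȳ turns the homogeneous equation into Φ(y) = Re(ȳ · T ȳ).
    have h2 := congrArg (fun v => (star y ⬝ᵥ v).re) h1
    simp only [dotProduct_sub, dotProduct_add, Complex.sub_re, Complex.add_re, ← h.conj_hess,
      Complex.conj_re, dotProduct_zero, Complex.zero_re] at h2
    rw [dotProduct_mulVec_symm, transpose_transpose] at h2
    have h3 := hneg y hne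
    rw [h.apply] at h3
    linarith
  obtain ⟨y, hy⟩ := LinearMap.surjective_of_injective hg (Kᵀ *ᵥ x)
  have hcrit : Kᵀ *ᵥ x + T *ᵥ star y = Lᵀ *ᵥ y + Pᴴ *ᵥ star y := by
    rw [← hy]
    change Lᵀ *ᵥ y + Pᴴ *ᵥ star y - T *ᵥ star y + T *ᵥ star y = _
    rw [sub_add_cancel]
  refine ⟨y, ⟨?_, ?_, 1 / δ, by positivity, fun t => ?_⟩⟩
  · refine hasFDerivAt_zero_of_add_eq ?_ (fun r w => ?_) (h.phaseWeight_add hT hcrit)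
    · have hy : Continuous (yPart : (Fin n ⊕ Fin n → ℂ) → _) :=
        continuous_pi fun j => continuous_apply _
      have hθ : Continuous (thetaPart : (Fin n ⊕ Fin n → ℂ) → _) :=
        continuous_pi fun j => continuous_apply _
      have := BargmannSpace.continuous_weight Φ
      change Continuous fun w => phaseWeight (kernelPhase P L R K T) Φ 0 w
      simp only [phaseWeight_kernelPhase, quadExponent]
      fun_prop
    · have e1 : yPart (r • w) = (r : ℂ) • yPart w := by funext j; simp [yPart]
      have e2 : thetaPart (r • w) = (r : ℂ) • thetaPart w := by funext j; simp [thetaPart]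
      have e3 : Φ ((r : ℂ) • yPart w) = r ^ 2 * Φ (yPart w) := by
        rw [Complex.coe_smul, QuadraticMap.map_smul]
        simp [sq]
      rw [phaseWeight_kernelPhase, phaseWeight_kernelPhase, e1, e2, e3, quadExponent_smul,
        ← smul_zero (r : ℂ), quadExponent_smul, smul_zero, ← mul_sub, ← Complex.ofReal_pow,
        Complex.re_ofReal_mul]
      ring
  · intro s t hst
    simp only [contourPoint_conjContour] at hst
    have h1 : complexCoord s = complexCoord t :=
      add_left_cancel (congrArg (yPart (N := n)) hst)
    funext i
    rcases i with j | j
    · exact congrArg Complex.re (congrFun h1 j)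
    · exact congrArg Complex.im (congrFun h1 j)
  · rw [contourPoint_conjContour, conjPoint_add, h.phaseWeight_add hT hcrit, dist_eq_norm,
      add_sub_cancel_left, phaseWeight_kernelPhase (x := 0), yPart_conjPoint, thetaPart_conjPoint,
      h.re_quadExponent_star]
    have h1 := hle (complexCoord t)
    have h2 := norm_conjPoint (complexCoord t)
    have h3 : ‖conjPoint (complexCoord t)‖ ^ 2 ≤ ‖complexCoord t‖ ^ 2 :=
      pow_le_pow_left₀ (norm_nonneg _) h2 2
    have h4 : quadExponent R K T 0 (star (complexCoord t))
        = star (complexCoord t) ⬝ᵥ T *ᵥ star (complexCoord t) := by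
      simp [quadExponent]
    rw [h4, one_div_one_div, Complex.sub_re, Complex.ofReal_re]
    nlinarith

/-- An operator with a Gaussian kernel is a Fourier integral operator. -/
theorem IsKernelRelation.isFourierIntegralOperator {Φ' : QuadraticForm ℝ (Fin n → ℂ)}
    {κ : PhaseSpace n →ₗ[ℂ] PhaseSpace n} (hrel : IsKernelRelation P L R K T κ)
    (hκ : IsCanonical κ) (h : IsHessianPair Φ P L) (hR : Rᵀ = R) (hT : Tᵀ = T)
    (hneg : ∀ y, y ≠ 0 → (star y ⬝ᵥ T *ᵥ star y).re < Φ y)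
    {A : BargmannSpace Φ →L[ℂ] BargmannSpace Φ'} {C : ℂ}
    (hA : ∀ u x, A u x = ∫ y, C * Complex.exp (quadExponent R K T x (star y)) * u y
      ∂(weightMeasure Φ)) : IsFourierIntegralOperator κ A := by
  -- On θ = ȳ the factor exp(-2Φ(y, θ)) of e^{iφ} is the weight e^{-2Φ(y)}; the amplitude absorbs
  -- the Jacobian of the contour.
  choose y hy using h.exists_isGoodContour (R := R) (K := K) hT hneg
  refine ⟨hκ, n, kernelPhase P L R K T, (conjContour n).det⁻¹ * C, fun x => conjPoint (y x),
    fun _ => conjContour n, isNondegeneratePhase_kernelPhase hR hT h, hrel.generates hR hT h, hy,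
    fun u x => ?_⟩
  rw [hA, integral_weightMeasure, contourIntegral_conjContour, ← integral_const_mul]
  refine integral_congr_ae (Filter.Eventually.of_forall fun v => ?_)
  simp only
  rw [yPart_conjPoint, thetaPart_conjPoint, kernelPhase_apply, h.re_quadExponent_star,
    show ∀ e : ℂ, Complex.I * (-Complex.I * e) = e by
      intro e; rw [← mul_assoc, mul_neg, Complex.I_mul_I]; ring, sub_eq_add_neg, Complex.exp_add,
    Complex.ofReal_exp]
  have hdet : (conjContour n).det ≠ 0 := det_conjContour_ne_zero
  push_cast
  field_simp

end Construction

/-! ### The adjoint operator and uniqueness of its canonical transformation -/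

section Adjoint

open Matrix

variable {n : ℕ}

/-- Each reflection conjugates σ, and the two conjugations cancel. -/
theorem IsCanonical.reflection_comp {Φ₁ Φ₂ : QuadraticForm ℝ (Fin n → ℂ)}
    (hΦ₁ : StrictlyPlurisubharmonic Φ₁) (hΦ₂ : StrictlyPlurisubharmonic Φ₂)
    {κ : PhaseSpace n ≃ₗ[ℂ] PhaseSpace n} (hκ : IsCanonical (κ : PhaseSpace n →ₗ[ℂ] PhaseSpace n)) :
    IsCanonical ((reflection hΦ₁).comp
      ((κ.symm : PhaseSpace n →ₗ[ℂ] PhaseSpace n).comp (reflection hΦ₂))) := by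
  obtain ⟨P₁, L₁, h₁⟩ := exists_isHessianPair hΦ₁
  obtain ⟨P₂, L₂, h₂⟩ := exists_isHessianPair hΦ₂
  intro μ ν
  have h := hκ (κ.symm (reflection hΦ₂ μ)) (κ.symm (reflection hΦ₂ ν))
  simp only [LinearEquiv.coe_coe, LinearEquiv.apply_symm_apply] at h
  simp only [LinearMap.comp_apply, LinearEquiv.coe_coe]
  rw [h₁.sympForm_reflection, ← h, h₂.sympForm_reflection, Complex.conj_conj]

/-- A non-zero operator is associated to at most one canonical transformation. -/
theorem IsFourierIntegralOperator.unique {Φ₁ Φ₂ : QuadraticForm ℝ (Fin n → ℂ)}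
    (hΦ₁ : StrictlyPlurisubharmonic Φ₁) {κ κ' : PhaseSpace n →ₗ[ℂ] PhaseSpace n}
    {A : BargmannSpace Φ₁ →L[ℂ] BargmannSpace Φ₂} (hA : IsFourierIntegralOperator κ A)
    (hA' : IsFourierIntegralOperator κ' A) (h0 : A ≠ 0) : κ' = κ := by
  obtain ⟨P, L, h⟩ := exists_isHessianPair hΦ₁
  obtain ⟨c, k, hk, hrep⟩ := h.exists_reproducing
  obtain ⟨C, R, K, T, hR, hT, hrel, hker⟩ := hA.exists_kernel h hk
  obtain ⟨C', R', K', T', hR', hT', hrel', hker'⟩ := hA'.exists_kernel h hk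
  -- If C = 0, then A annihilates every k_y, so A*v(y) = (A k_y, v) = 0 for all v and y.
  have hC : C ≠ 0 := by
    rintro rfl
    refine h0 ?_
    have hadj : ContinuousLinearMap.adjoint A = 0 := by
      refine ContinuousLinearMap.ext fun v => BargmannSpace.ext fun y => ?_
      have hAk : A (k y) = 0 := BargmannSpace.ext fun x => by
        rw [hker, zero_mul]
        rfl
      rw [← hrep, ContinuousLinearMap.adjoint_inner_right, hAk, inner_zero_left]
      rfl
    rw [← ContinuousLinearMap.adjoint_adjoint A, hadj, map_zero]
  obtain ⟨rfl, rfl, rfl⟩ := eq_of_exp_quadExponent_eq hR hT hR' hT' hC fun x y => by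
    rw [← hker, hker']
  exact hrel.unique hrel' h

/-- The adjoint of a Fourier integral operator associated to a positive canonical transformation. -/
theorem IsFourierIntegralOperator.adjoint {Φ₁ Φ₂ : QuadraticForm ℝ (Fin n → ℂ)}
    (hΦ₁ : StrictlyPlurisubharmonic Φ₁) (hΦ₂ : StrictlyPlurisubharmonic Φ₂)
    {κ : PhaseSpace n ≃ₗ[ℂ] PhaseSpace n}
    (hpos : IsPositiveRel hΦ₂ hΦ₁ (κ : PhaseSpace n →ₗ[ℂ] PhaseSpace n))
    {A : BargmannSpace Φ₁ →L[ℂ] BargmannSpace Φ₂}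
    (hA : IsFourierIntegralOperator (κ : PhaseSpace n →ₗ[ℂ] PhaseSpace n) A) :
    IsFourierIntegralOperator ((reflection hΦ₁).comp
      ((κ.symm : PhaseSpace n →ₗ[ℂ] PhaseSpace n).comp (reflection hΦ₂)))
      (ContinuousLinearMap.adjoint A) := by
  obtain ⟨P₁, L₁, h₁⟩ := exists_isHessianPair hΦ₁
  obtain ⟨P₂, L₂, h₂⟩ := exists_isHessianPair hΦ₂
  obtain ⟨c, k, hk, hrep⟩ := h₁.exists_reproducing
  obtain ⟨C, R, K, T, hR, hT, hrel, hker⟩ := hA.exists_kernel h₁ hk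
  have hsymm : ∀ {Q : Matrix (Fin n) (Fin n) ℂ}, Qᵀ = Q → Qᴴᵀ = Qᴴ :=
    fun hQ => conjTranspose_transpose_of_symm hQ
  refine (hrel.adjoint h₁ h₂ hΦ₁ hΦ₂ hR hT).isFourierIntegralOperator (C := conj C)
    (hA.1.reflection_comp hΦ₁ hΦ₂) h₂ (hsymm hT) (hsymm hR) (fun x hx => ?_) fun v y => ?_
  -- The θθ block of the adjoint exponent is Rᴴ, so the good contour condition concerns Re(x · R x),
  -- which positivity bounds.
  · rw [← conj_dotProduct_mulVec, Complex.conj_re]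
    exact hrel.re_lt_of_isPositiveRel h₁ h₂ hpos hx
  -- A*v(y) = (k_y, A*v) = (A k_y, v), so the kernel of A* is the conjugate of A k_y.
  · rw [← hrep, ContinuousLinearMap.adjoint_inner_right, BargmannSpace.inner_def]
    simp only [hker, map_mul, ← Complex.exp_conj, conj_quadExponent]

end Adjoint

theorem mainTheorem7 (n : ℕ) (Φ₁ Φ₂ : QuadraticForm ℝ (Fin n → ℂ))
    (hΦ₁ : StrictlyPlurisubharmonic Φ₁) (hΦ₂ : StrictlyPlurisubharmonic Φ₂)
    (κ : PhaseSpace n ≃ₗ[ℂ] PhaseSpace n) (hκ : IsCanonical (κ : PhaseSpace n →ₗ[ℂ] PhaseSpace n))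
    (hpos : IsPositiveRel hΦ₂ hΦ₁ (κ : PhaseSpace n →ₗ[ℂ] PhaseSpace n))
    (A : BargmannSpace Φ₁ →L[ℂ] BargmannSpace Φ₂)
    (hA : IsFourierIntegralOperator (κ : PhaseSpace n →ₗ[ℂ] PhaseSpace n) A) :
    IsFourierIntegralOperator ((reflection hΦ₁).comp
        ((κ.symm : PhaseSpace n →ₗ[ℂ] PhaseSpace n).comp (reflection hΦ₂)))
      (ContinuousLinearMap.adjoint A) ∧
    (A ≠ 0 → ∀ κ' : PhaseSpace n →ₗ[ℂ] PhaseSpace n,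
      IsFourierIntegralOperator κ' (ContinuousLinearMap.adjoint A) →
        κ' = (reflection hΦ₁).comp
          ((κ.symm : PhaseSpace n →ₗ[ℂ] PhaseSpace n).comp (reflection hΦ₂))) :=
  ⟨hA.adjoint hΦ₁ hΦ₂ hpos, fun h0 _ h' =>
    (hA.adjoint hΦ₁ hΦ₂ hpos).unique hΦ₂ h' fun h => h0 (by
      rw [← ContinuousLinearMap.adjoint_adjoint A, h, map_zero])⟩
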